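/- Let $K\ge 1$ sensors observe $y_t^k = x h_t^k + w_t^k$, $t=1,2,\dots$, $k=1,\dots,K$, where $x\in\mathbb{C}$ is an unknown constant. The noises $w_t^k\sim\mathcal{N}_c(0,\sigma_k^2)$, $\sigma_k>0$, are circularly symmetric complex Gaussian and independent across $t$ and $k$. The channel gains $h_t^k\in\mathbb{C}$ are, for each $k$, i.i.d. across $t$ with $\mathsf{E}[|h_1^k|^2]<\infty$, and the gains are jointly independent of the noises. Assume (A1) $0<|\Re(x)|,|\Im(x)|<\infty$, and (A2) almost surely $0<|h_t^k|<\infty$ for all $k,t$. Put $U_t^k=\sum_{\tau=1}^t \frac{2|h_\tau^k|^2}{\sigma_k^2}$ and, when the real part of $x$ is estimated, $V_t^k=\sum_{\tau=1}^t\frac{2\Re((h_\tau^k)^*y_\tau^k)}{\sigma_k^2}$; for the imaginary part replace $\Re$ by $\Im$ (here $^*$ is complex conjugation). The estimator LT-dsDMLE with target Fisher information $\mathcal{I}$, thresholds $d_k,e_k$, quantizer ranges $\phi_k,\theta_k>0$ and $r_U,r_V\ge1$ bits per message works as follows. * $t_{0,U}^k=0$ and $t_{n,U}^k=\min\{t>t_{n-1,U}^k: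 U_t^k-U^k_{t_{n-1,U}^k}\ge e_k\}$. With $u_n^k=U^k_{t_{n,U}^k}-U^k_{t_{n-1,U}^k}$, let $\tilde u_n^k=e_k+\tilde p_n^k$, where $\tilde p_n^k$ is $u_n^k-e_k$ quantized by the uniform mid-riser quantizer with $2^{r_U}$ cells on $[0,\theta_k]$. * $t_{0,V}^k=0$ and $t_{n,V}^k=\min\{t>t_{n-1,V}^k: V_t^k-V^k_{t_{n-1,V}^k}\notin(-d_k,d_k)\}$. With $v_n^k=V^k_{t_{n,V}^k}-V^k_{t_{n-1,V}^k}$, let $\tilde v_n^k=\mathrm{sign}(v_n^k)(d_k+\tilde q_n^k)$, where $\tilde q_n^k$ is $|v_n^k|-d_k$ quantized by the uniform mid-riser quantizer with $2^{r_V-1}$ cells on $[0,\phi_k]$. * A uniform mid-riser quantizer maps a value to the midpoint of its cell, and a value beyond the range to the largest level. * $\tilde U_t=\sum_k\sum_{n\ge1:\,t_{n,U}^k\le t}\tilde u_n^k$, $\ \tilde V_t=\sum_k\sum_{n\ge1:\,t_{n,V}^k\le t}\tilde v_n^k$, $\ \tilde{\mathcal{T}}=\min\{t:\tilde U_t\ge\mathcal{I}\}$,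 $\ \tilde x_{\tilde{\mathcal{T}}}=\tilde V_{\tilde{\mathcal{T}}}/\tilde U_{\tilde{\mathcal{T}}}$. Let $d_k,e_k,\phi_k,\theta_k,r_U,r_V$ depend on $\mathcal{I}$ in such a way that, as $\mathcal{I}\to\infty$, for every $k$: $d_k\to\infty$ and $e_k\to\infty$ at slower rates than $\mathcal{I}$, i.e., $d_k=o(\mathcal{I})$ and $e_k=o(\mathcal{I})$, while $\phi_k=O(1)$ and $\theta_k=O(1)$. Let $\mathcal{H}_{\tilde{\mathcal{T}}}$ be the $\sigma$-algebra generated by $\tilde{\mathcal{T}}$ and the gains $h_\tau^k$, $\tau\le\tilde{\mathcal{T}}$, $k\le K$. Then for all large $\mathcal{I}$ the time $\tilde{\mathcal{T}}$ is almost surely finite and $\tilde x_{\tilde{\mathcal{T}}}$ is integrable. Write $a=\Re(x)$ (respectively $a=\Im(x)$, for the estimator of the imaginary part). As $\mathcal{I}\to\infty$, LT-dsDMLE is asymptotically unbiased, i.e., $\mathsf{E}[\tilde x_{\tilde{\mathcal{T}}}-a\mid\mathcal{H}_{\tilde{\mathcal{T}}}]\to0$ almost surely, and consistent, i.e., $\tilde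 x_{\tilde{\mathcal{T}}}\to a$ in probability, and also conditionally: $\mathsf{P}(|\tilde x_{\tilde{\mathcal{T}}}-a|\ge\varepsilon\mid\mathcal{H}_{\tilde{\mathcal{T}}})\to0$ almost surely for every $\varepsilon>0$. (The almost sure limits are taken along an arbitrary sequence $\mathcal{I}_n\to\infty$.) -/

import Mathlib

open MeasureTheory ProbabilityTheory Filter Topology Asymptotics
open scoped ComplexConjugate

namespace LTdsDMLE

/-- The law `N_c(0, s²)` of a circularly symmetric complex Gaussian variable: the real and the
imaginary part are independent, centred, of variance `s² / 2` each. -/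
noncomputable def complexGaussian (s : ℝ) : Measure ℂ :=
  ((gaussianReal 0 (Real.toNNReal (s ^ 2 / 2))).prod
    (gaussianReal 0 (Real.toNNReal (s ^ 2 / 2)))).map (fun p : ℝ × ℝ => (⟨p.1, p.2⟩ : ℂ))

/-! The local processes of one sensor with noise level `s`. The entry `τ` of a sequence of gains or
of observations belongs to the `(τ + 1)`-st time instant, so that the sum over `τ < t` runs over the
first `t` instants. -/

/-- `U_t`: the Fisher information gathered by one sensor up to time `t`. -/
noncomputable def localU (s : ℝ) (g : ℕ → ℂ) (t : ℕ) : ℝ :=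
  ∑ τ ∈ Finset.range t, 2 * ‖g τ‖ ^ 2 / s ^ 2

/-- `V_t`: the sufficient statistic of one sensor up to time `t`. The map `part` is `Complex.re` when
the real part of the parameter is estimated and `Complex.im` for the imaginary part. -/
noncomputable def localV (part : ℂ → ℝ) (s : ℝ) (g y : ℕ → ℂ) (t : ℕ) : ℝ :=
  ∑ τ ∈ Finset.range t, 2 * part (conj (g τ) * y τ) / s ^ 2

/-- Level-triggered sampling times of the path `Z`: `t_0 = 0`, and `t_{n+1}` is the least `t > t_n`
with `Z t - Z t_n ∈ A` (it is `⊤` if there is none). -/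
noncomputable def sampTime (Z : ℕ → ℝ) (A : Set ℝ) : ℕ → ℕ∞
  | 0 => 0
  | n + 1 => sInf {s : ℕ∞ | ∃ t : ℕ, s = (t : ℕ∞) ∧ sampTime Z A n < (t : ℕ∞) ∧
      Z t - Z (sampTime Z A n).toNat ∈ A}

/-- The increment `Z_{t_n} - Z_{t_{n-1}}` between consecutive sampling times (for `n ≥ 1`). -/
noncomputable def incr (Z : ℕ → ℝ) (A : Set ℝ) (n : ℕ) : ℝ :=
  Z (sampTime Z A n).toNat - Z (sampTime Z A (n - 1)).toNat

open Classical in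
/-- The number of sampling times `t_n`, `n ≥ 1`, with `t_n ≤ t`. As `t_n ≥ n`, only `n ≤ t` can
count. -/
noncomputable def msgCount (Z : ℕ → ℝ) (A : Set ℝ) (t : ℕ) : ℕ :=
  ((Finset.Icc 1 t).filter (fun n => sampTime Z A n ≤ (t : ℕ∞))).card

/-- The mid-riser uniform quantizer with `L` cells on `[0, c]`: the midpoint of the cell of `p`;
values beyond `c` go to the largest level. -/
noncomputable def midRiser (c : ℝ) (L : ℕ) (p : ℝ) : ℝ :=
  (((min ⌊p / (c / L)⌋₊ (L - 1) : ℕ) : ℝ) + 1 / 2) * (c / L)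

/-- What the fusion center recovers of a nondecreasing path `Z` at time `t`: threshold `e`, and
`r` bits for the overshoot, quantized on `[0, θ]`. -/
noncomputable def recoverU (e θ : ℝ) (r : ℕ) (Z : ℕ → ℝ) (t : ℕ) : ℝ :=
  ∑ n ∈ Finset.Icc 1 (msgCount Z (Set.Ici e) t),
    (e + midRiser θ (2 ^ r) (incr Z (Set.Ici e) n - e))

/-- What the fusion center recovers of a path `Z` at time `t`: thresholds `d` and `-d`, one bit for
the sign, and `r - 1` bits for the overshoot of the absolute value, quantized on `[0, φ]`. -/
noncomputable def recoverV (d φ : ℝ) (r : ℕ) (Z : ℕ → ℝ) (t : ℕ) : ℝ :=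
  ∑ n ∈ Finset.Icc 1 (msgCount Z (Set.Ioo (-d) d)ᶜ t),
    Real.sign (incr Z (Set.Ioo (-d) d)ᶜ n) *
      (d + midRiser φ (2 ^ (r - 1)) (|incr Z (Set.Ioo (-d) d)ᶜ n| - d))

/-- The design parameters of the scheme with `K` sensors: the sampling thresholds `e k` (for `U`) and
`d k` (for `V`), the ranges `θ k` and `φ k` of the overshoot quantizers, and the numbers of bits per
message `rU` and `rV`. -/
structure Design (K : ℕ) where
  e : Fin K → ℝ
  d : Fin K → ℝ
  θ : Fin K → ℝ
  φ : Fin K → ℝ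
  rU : ℕ
  rV : ℕ

variable {K : ℕ}

/-- The fusion center's approximation of the global Fisher information at time `t`. -/
noncomputable def fusedU (D : Design K) (σ : Fin K → ℝ) (g : Fin K → ℕ → ℂ) (t : ℕ) : ℝ :=
  ∑ k, recoverU (D.e k) (D.θ k) D.rU (localU (σ k) (g k)) t

/-- The fusion center's approximation of the global sufficient statistic at time `t`. -/
noncomputable def fusedV (D : Design K) (part : ℂ → ℝ) (σ : Fin K → ℝ) (g y : Fin K → ℕ → ℂ)
    (t : ℕ) : ℝ :=
  ∑ k, recoverV (D.d k) (D.φ k) D.rV (localV part (σ k) (g k) (y k)) t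

/-- The stopping time: the first `t` at which the approximate Fisher information reaches the target
`J` (and `0` if it never does). -/
noncomputable def stopTime (D : Design K) (σ : Fin K → ℝ) (J : ℝ) (g : Fin K → ℕ → ℂ) : ℕ :=
  sInf {t : ℕ | J ≤ fusedU D σ g t}

/-- The final estimate of LT-dsDMLE for the target `J`. -/
noncomputable def estimate (D : Design K) (part : ℂ → ℝ) (σ : Fin K → ℝ) (J : ℝ)
    (g y : Fin K → ℕ → ℂ) : ℝ :=
  fusedV D part σ g y (stopTime D σ J g) / fusedU D σ g (stopTime D σ J g)

variable {Ω : Type*} [MeasurableSpace Ω]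

/-- The information contained in the channel gains of all sensors up to the random time `T`. -/
@[reducible]
noncomputable def gainsUpTo (h : Fin K → ℕ → Ω → ℂ) (T : Ω → ℕ) : MeasurableSpace Ω :=
  MeasurableSpace.comap
    (fun ω => ((T ω, fun k τ => if τ < T ω then h k τ ω else 0) : ℕ × (Fin K → ℕ → ℂ)))
    inferInstance

/-- Asymptotic conditional unbiasedness of the estimators `X J` of `a` given `m J` as `J → ∞`: the
estimators are eventually integrable, and the conditional expectations of `X J - a` given `m J` tend
to zero almost surely, along every sequence of values of `J` that tends to infinity. -/
def AsympUnbiased (P : Measure Ω) (m : ℝ → MeasurableSpace Ω) (X : ℝ → Ω → ℝ) (a : ℝ) : Prop :=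
  (∀ᶠ J in atTop, Integrable (X J) P) ∧
  ∀ J : ℕ → ℝ, Tendsto J atTop atTop →
    ∀ᵐ ω ∂P, Tendsto (fun n => (P[fun ω' => X (J n) ω' - a | m (J n)]) ω) atTop (𝓝 0)

/-- Consistency of the estimators `X J` of `a` as `J → ∞`: convergence in probability, both
unconditionally and conditionally given `m J`. -/
def Consistent (P : Measure Ω) (m : ℝ → MeasurableSpace Ω) (X : ℝ → Ω → ℝ) (a : ℝ) : Prop :=
  TendstoInMeasure P X atTop (fun _ => a) ∧
  ∀ ε : ℝ, 0 < ε → ∀ J : ℕ → ℝ, Tendsto J atTop atTop →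
    ∀ᵐ ω ∂P, Tendsto (fun n => (P⟦{ω' | ε ≤ |X (J n) ω' - a|} | m (J n)⟧) ω) atTop (𝓝 0)

end LTdsDMLE

/-! The stopping time depends on the gains alone, and the gains are independent of the noise.
Conditioning on `gainsUpTo` therefore means freezing the gains and the time and integrating over the
noise (`condExp_estimate_ae_eq`). Everything reduces to convergence in L¹ of the estimate along one
frozen gain path (`eventually_integral_abs_estimateOf_sub_le`): unbiasedness is then immediate,
conditional consistency is Markov's inequality, and convergence in probability follows by dominated
convergence.

For frozen gains, V_t = a U_t + W_t, where W_t is a sum of independent centred noise terms with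
variance U_t. By the strong law almost every gain path is regular (`ae_regularIncrements`): U_t
grows linearly and its large increments contribute little. Sampling with threshold d loses less than
d through the unsent remainder, and per message at most the quantizer range plus the overshoot. The
overshoot is at most the last increment of the path, and there are at most (variation)/d messages.
Cutting increments at a fixed level M bounds the error by d, plus O((φ + M)/d) times the variation,
plus the excess over M (`abs_sub_sampledSum_le`). As d tends to infinity with d = o(J), this is at
most δ(J + t) for large J, uniformly in t (`RegularIncrements.eventually_errorBound_le`). At the
stopping time T the recovered U is at least J and T = O(J), so the ratio misses a by O(δ) in mean.

Integrability is separate: the estimate is at most a constant times T, and T has a geometric tail by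
Chernoff's bound for the capped increments of a single sensor. -/

namespace LTdsDMLE

/-! ### Sampling times rewritten as a recursion in time -/

section Sampling

variable (Z : ℕ → ℝ) (A : Set ℝ)

open Classical in
/-- The value of the path `Z` at its last sampling time up to time `t`. -/
noncomputable def refLevel : ℕ → ℝ
  | 0 => Z 0
  | t + 1 => if Z (t + 1) - refLevel t ∈ A then Z (t + 1) else refLevel t

open Classical in
/-- The sum of `f` over all increments of `Z` that are sampled up to time `t`. -/
noncomputable def sampledSum (f : ℝ → ℝ) (t : ℕ) : ℝ :=
  ∑ s ∈ Finset.range t,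
    if Z (s + 1) - refLevel Z A s ∈ A then f (Z (s + 1) - refLevel Z A s) else 0

open Classical in
lemma sampledSum_succ (f : ℝ → ℝ) (t : ℕ) :
    sampledSum Z A f (t + 1) = sampledSum Z A f t +
      if Z (t + 1) - refLevel Z A t ∈ A then f (Z (t + 1) - refLevel Z A t) else 0 :=
  Finset.sum_range_succ _ _

lemma sampTime_add_one_le (n : ℕ) : sampTime Z A n + 1 ≤ sampTime Z A (n + 1) := by
  rw [sampTime]
  refine le_sInf ?_
  rintro s ⟨t, rfl, ht, -⟩
  exact Order.add_one_le_of_lt ht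

lemma sampTime_mono : Monotone (sampTime Z A) :=
  monotone_nat_of_le_succ fun n => le_trans le_self_add (sampTime_add_one_le Z A n)

lemma le_sampTime (n : ℕ) : (n : ℕ∞) ≤ sampTime Z A n := by
  induction n with
  | zero => simp
  | succ n ih =>
    refine le_trans ?_ (sampTime_add_one_le Z A n)
    push_cast
    gcongr

lemma msgCount_eq {N t : ℕ} (h1 : sampTime Z A N ≤ t) (h2 : (t : ℕ∞) < sampTime Z A (N + 1)) :
    msgCount Z A t = N := by
  classical
  have : (Finset.Icc 1 t).filter (fun n => sampTime Z A n ≤ (t : ℕ∞)) = Finset.Icc 1 N := by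
    ext n
    simp only [Finset.mem_filter, Finset.mem_Icc]
    constructor
    · rintro ⟨⟨hn, -⟩, hn'⟩
      refine ⟨hn, ?_⟩
      by_contra! hc
      exact absurd (lt_of_lt_of_le h2 (sampTime_mono Z A hc)) (not_lt.mpr hn')
    · rintro ⟨hn, hn'⟩
      have h3 := (sampTime_mono Z A hn').trans h1
      exact ⟨⟨hn, by exact_mod_cast (le_sampTime Z A n).trans h3⟩, h3⟩
  unfold msgCount
  convert congrArg Finset.card this using 1
  simp

lemma sampTime_succ_of_mem {N t : ℕ} (h1 : sampTime Z A N ≤ t)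
    (h2 : (t : ℕ∞) < sampTime Z A (N + 1))
    (hm : Z (t + 1) - Z (sampTime Z A N).toNat ∈ A) :
    sampTime Z A (N + 1) = (t + 1 : ℕ) := by
  apply le_antisymm
  · rw [sampTime]
    refine sInf_le ⟨t + 1, rfl, lt_of_le_of_lt h1 ?_, hm⟩
    exact_mod_cast Nat.lt_succ_self t
  · push_cast
    exact Order.add_one_le_of_lt h2

lemma lt_sampTime_succ_of_notMem {N t : ℕ}
    (h2 : (t : ℕ∞) < sampTime Z A (N + 1))
    (hm : Z (t + 1) - Z (sampTime Z A N).toNat ∉ A) :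
    ((t + 1 : ℕ) : ℕ∞) < sampTime Z A (N + 1) := by
  have h3 : ((t + 1 : ℕ) : ℕ∞) + 1 ≤ sampTime Z A (N + 1) := by
    rw [sampTime] at h2 ⊢
    refine le_sInf ?_
    rintro s ⟨t', rfl, ht, hA⟩
    have h4 : (t : ℕ∞) < (t' : ℕ∞) := lt_of_lt_of_le h2 (sInf_le ⟨t', rfl, ht, hA⟩)
    have h5 : t < t' := by exact_mod_cast h4
    have h6 : t' ≠ t + 1 := by rintro rfl; exact hm hA
    have : t + 1 + 1 ≤ t' := by omega
    exact_mod_cast this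
  refine lt_of_lt_of_le ?_ h3
  exact_mod_cast Nat.lt_succ_self (t + 1)

/-- The induction invariant linking the two descriptions: with N messages so far, t lies in [t_N,
t_{N+1}), and the recursive reference level is the path at t_N. -/
lemma msgCount_spec (t : ℕ) :
    sampTime Z A (msgCount Z A t) ≤ t ∧ (t : ℕ∞) < sampTime Z A (msgCount Z A t + 1) ∧
      Z (sampTime Z A (msgCount Z A t)).toNat = refLevel Z A t := by
  induction t with
  | zero =>
    have h0 : msgCount Z A 0 = 0 := by simp [msgCount]
    rw [h0]
    refine ⟨by simp [sampTime], ?_, by simp [sampTime, refLevel]⟩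
    refine lt_of_lt_of_le ?_ (le_sampTime Z A (0 + 1))
    simp
  | succ t ih =>
    obtain ⟨h1, h2, h3⟩ := ih
    by_cases hm : Z (t + 1) - refLevel Z A t ∈ A
    · have h4 := sampTime_succ_of_mem Z A h1 h2 (by rwa [h3])
      have h5 : ((t + 1 : ℕ) : ℕ∞) < sampTime Z A (msgCount Z A t + 1 + 1) := by
        refine lt_of_lt_of_le ?_ (sampTime_add_one_le Z A _)
        rw [h4]
        exact_mod_cast Nat.lt_succ_self (t + 1)
      have h6 := msgCount_eq Z A h4.le h5
      rw [h6]
      refine ⟨h4.le, h5, ?_⟩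
      rw [h4, ENat.toNat_natCast, refLevel, if_pos hm]
    · have h4 := lt_sampTime_succ_of_notMem Z A h2 (by rwa [h3])
      have h5 : sampTime Z A (msgCount Z A t) ≤ (t + 1 : ℕ) :=
        h1.trans (by exact_mod_cast Nat.le_succ t)
      have h6 := msgCount_eq Z A h5 h4
      rw [h6]
      exact ⟨h5, h4, by simp [refLevel, hm, h3]⟩

lemma sum_incr_eq_sampledSum (f : ℝ → ℝ) (t : ℕ) :
    ∑ n ∈ Finset.Icc 1 (msgCount Z A t), f (incr Z A n) = sampledSum Z A f t := by
  induction t with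
  | zero => simp [msgCount, sampledSum]
  | succ t ih =>
    obtain ⟨h1, h2, h3⟩ := msgCount_spec Z A t
    rw [sampledSum_succ, ← ih]
    by_cases hm : Z (t + 1) - refLevel Z A t ∈ A
    · have h4 := sampTime_succ_of_mem Z A h1 h2 (by rwa [h3])
      have h5 : ((t + 1 : ℕ) : ℕ∞) < sampTime Z A (msgCount Z A t + 1 + 1) := by
        refine lt_of_lt_of_le ?_ (sampTime_add_one_le Z A _)
        rw [h4]
        exact_mod_cast Nat.lt_succ_self (t + 1)
      rw [msgCount_eq Z A h4.le h5, Finset.sum_Icc_succ_top (by omega), if_pos hm]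
      congr 2
      rw [incr, h4, Nat.add_sub_cancel, h3, ENat.toNat_natCast]
    · have h4 := lt_sampTime_succ_of_notMem Z A h2 (by rwa [h3])
      have h5 : sampTime Z A (msgCount Z A t) ≤ (t + 1 : ℕ) :=
        h1.trans (by exact_mod_cast Nat.le_succ t)
      rw [msgCount_eq Z A h5 h4, if_neg hm, add_zero]

/-- The value that represents an increment `v` at the fusion center. -/
noncomputable def quantize (d φ : ℝ) (L : ℕ) (v : ℝ) : ℝ :=
  Real.sign v * (d + midRiser φ L (|v| - d))

lemma recoverV_eq (d φ : ℝ) (r t : ℕ) :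
    recoverV d φ r Z t = sampledSum Z (Set.Ioo (-d) d)ᶜ (quantize d φ (2 ^ (r - 1))) t := by
  rw [recoverV, ← sum_incr_eq_sampledSum]
  rfl

variable {Z}

lemma refLevel_le_of_monotone (hZ : Monotone Z) (t : ℕ) : refLevel Z A t ≤ Z t := by
  induction t with
  | zero => simp [refLevel]
  | succ t ih =>
    rw [refLevel]
    split_ifs
    · exact le_rfl
    · exact ih.trans (hZ t.le_succ)

lemma mem_Ici_iff_of_nonneg {e v : ℝ} (hv : 0 ≤ v) (he : 0 < e) :
    v ∈ Set.Ici e ↔ v ∈ (Set.Ioo (-e) e)ᶜ := by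
  simp only [Set.mem_Ici, Set.mem_compl_iff, Set.mem_Ioo, not_and, not_lt]
  exact ⟨fun h _ => h, fun h => h (by linarith)⟩

/-- A nondecreasing path never reaches the lower threshold, so one-sided sampling is a case of
two-sided sampling and the same error bounds serve U and V. -/
lemma refLevel_Ici_eq (hZ : Monotone Z) {e : ℝ} (he : 0 < e) (t : ℕ) :
    refLevel Z (Set.Ici e) t = refLevel Z (Set.Ioo (-e) e)ᶜ t := by
  induction t with
  | zero => simp [refLevel]
  | succ t ih =>
    have h1 : 0 ≤ Z (t + 1) - refLevel Z (Set.Ici e) t :=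
      sub_nonneg.mpr ((refLevel_le_of_monotone _ hZ t).trans (hZ t.le_succ))
    have h2 := mem_Ici_iff_of_nonneg h1 he
    rw [ih] at h2
    rw [refLevel, refLevel, ih]
    by_cases hm : Z (t + 1) - refLevel Z (Set.Ioo (-e) e)ᶜ t ∈ Set.Ici e
    · rw [if_pos hm, if_pos (h2.mp hm)]
    · rw [if_neg hm, if_neg (fun h => hm (h2.mpr h))]

lemma recoverU_eq (hZ : Monotone Z) {e : ℝ} (he : 0 < e) (θ : ℝ) (r t : ℕ) :
    recoverU e θ r Z t = sampledSum Z (Set.Ioo (-e) e)ᶜ (quantize e θ (2 ^ r)) t := by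
  have h := sum_incr_eq_sampledSum Z (Set.Ici e) (fun v => e + midRiser θ (2 ^ r) (v - e)) t
  rw [recoverU, h, sampledSum, sampledSum]
  refine Finset.sum_congr rfl fun s _ => ?_
  have h1 : 0 ≤ Z (s + 1) - refLevel Z (Set.Ici e) s :=
    sub_nonneg.mpr ((refLevel_le_of_monotone _ hZ s).trans (hZ s.le_succ))
  have h2 := mem_Ici_iff_of_nonneg h1 he
  rw [refLevel_Ici_eq hZ he] at h1 h2 ⊢
  by_cases hm : Z (s + 1) - refLevel Z (Set.Ioo (-e) e)ᶜ s ∈ Set.Ici e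
  · rw [if_pos hm, if_pos (h2.mp hm), quantize, Real.sign_of_pos (lt_of_lt_of_le he hm),
      abs_of_nonneg h1, one_mul]
  · rw [if_neg hm, if_neg (fun h => hm (h2.mpr h))]

end Sampling

/-! ### Bounds for the quantizer -/

section Quantization

lemma midRiser_nonneg {c : ℝ} (hc : 0 < c) (L : ℕ) (p : ℝ) : 0 ≤ midRiser c L p := by
  unfold midRiser
  positivity

lemma midRiser_le {c : ℝ} (hc : 0 < c) {L : ℕ} (hL : 0 < L) (p : ℝ) : midRiser c L p ≤ c := by
  unfold midRiser
  have hL' : (0 : ℝ) < L := by exact_mod_cast hL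
  have h1 : ((min ⌊p / (c / L)⌋₊ (L - 1) : ℕ) : ℝ) ≤ L - 1 := by
    have : min ⌊p / (c / L)⌋₊ (L - 1) + 1 ≤ L := by omega
    have h2 : ((min ⌊p / (c / L)⌋₊ (L - 1) + 1 : ℕ) : ℝ) ≤ L := by exact_mod_cast this
    rw [Nat.cast_add, Nat.cast_one] at h2
    linarith
  calc _ ≤ (L : ℝ) * (c / L) := by gcongr; linarith
    _ = c := by field_simp

lemma abs_quantize_le {d φ : ℝ} (hd : 0 < d) (hφ : 0 < φ) {L : ℕ} (hL : 0 < L) (v : ℝ) :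
    |quantize d φ L v| ≤ d + φ := by
  rw [quantize, abs_mul, abs_of_nonneg (add_nonneg hd.le (midRiser_nonneg hφ L _))]
  have h1 : |Real.sign v| ≤ 1 := by
    rcases Real.sign_apply_eq v with h | h | h <;> simp [h]
  have h2 := midRiser_le hφ hL (|v| - d)
  have h3 := midRiser_nonneg hφ L (|v| - d)
  calc _ ≤ 1 * (d + midRiser φ L (|v| - d)) := by gcongr
    _ ≤ d + φ := by linarith

lemma le_quantize {d φ : ℝ} (hφ : 0 < φ) (L : ℕ) {v : ℝ} (hv : 0 < v) :
    d ≤ quantize d φ L v := by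
  rw [quantize, Real.sign_of_pos hv, one_mul]
  linarith [midRiser_nonneg hφ L (|v| - d)]

/-- Only the fact that the recovered overshoot lies in [0, φ] enters, so the bound also covers
saturation. -/
lemma abs_sub_quantize_le {d φ : ℝ} (hd : 0 < d) (hφ : 0 < φ) {L : ℕ} (hL : 0 < L) {v : ℝ}
    (hv : d ≤ |v|) : |v - quantize d φ L v| ≤ φ + (|v| - d) := by
  have h0 : |v| ≠ 0 := by linarith
  have h1 : v = Real.sign v * |v| := by
    rcases lt_or_gt_of_ne (abs_ne_zero.mp h0) with h | h
    · simp [Real.sign_of_neg h, abs_of_neg h]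
    · simp [Real.sign_of_pos h, abs_of_pos h]
  have h2 : |Real.sign v| ≤ 1 := by
    rcases Real.sign_apply_eq v with h | h | h <;> simp [h]
  have h3 := midRiser_le hφ hL (|v| - d)
  have h4 := midRiser_nonneg hφ L (|v| - d)
  have h5 : v - quantize d φ L v = Real.sign v * (|v| - d - midRiser φ L (|v| - d)) := by
    rw [quantize]; linear_combination h1
  rw [h5, abs_mul]
  calc _ ≤ 1 * |(|v| - d - midRiser φ L (|v| - d))| := by gcongr
    _ ≤ φ + (|v| - d) := by
      rw [one_mul, abs_le]; constructor <;> linarith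

end Quantization

/-! ### Deterministic error bounds for a sampled path -/

section PathBounds

variable (Z : ℕ → ℝ) {d : ℝ}

lemma abs_sub_lt_of_notMem {v : ℝ} (h : v ∉ (Set.Ioo (-d) d)ᶜ) : |v| < d := by
  rw [Set.notMem_compl_iff] at h
  exact abs_lt.mpr h

lemma le_abs_of_mem {v : ℝ} (h : v ∈ (Set.Ioo (-d) d)ᶜ) : d ≤ |v| := by
  by_contra! hc
  exact h (abs_lt.mp hc)

lemma abs_sub_refLevel_lt (hd : 0 < d) (t : ℕ) :
    |Z t - refLevel Z (Set.Ioo (-d) d)ᶜ t| < d := by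
  induction t with
  | zero => simpa [refLevel] using hd
  | succ t ih =>
    rw [refLevel]
    split_ifs with h
    · simpa using hd
    · exact abs_sub_lt_of_notMem h

/-- The number of samples, times the threshold, is at most the variation of the path. -/
lemma sampledSum_const_le (t : ℕ) :
    sampledSum Z (Set.Ioo (-d) d)ᶜ (fun _ => d) t + |Z t - refLevel Z (Set.Ioo (-d) d)ᶜ t|
      ≤ ∑ s ∈ Finset.range t, |Z (s + 1) - Z s| := by
  induction t with
  | zero => simp [sampledSum, refLevel]
  | succ t ih =>
    rw [sampledSum_succ, Finset.sum_range_succ, refLevel]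
    -- The distance to the reference level is a potential: it grows at most by the variation, and
    -- each sample resets it from at least d to 0.
    have h1 : |Z (t + 1) - refLevel Z (Set.Ioo (-d) d)ᶜ t| ≤
        |Z (t + 1) - Z t| + |Z t - refLevel Z (Set.Ioo (-d) d)ᶜ t| := abs_sub_le _ _ _
    split_ifs with h
    · have := le_abs_of_mem h
      simp only [sub_self, abs_zero]
      linarith
    · linarith

/-- The error of the recovered path, for every truncation level `M`. -/
lemma abs_sub_sampledSum_le (hd : 0 < d) {φ : ℝ} (hφ : 0 < φ) {L : ℕ} (hL : 0 < L) {M : ℝ}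
    (hM : 0 ≤ M) (t : ℕ) :
    |Z t - Z 0 - sampledSum Z (Set.Ioo (-d) d)ᶜ (quantize d φ L) t| ≤
      d + (φ + M) / d * ∑ s ∈ Finset.range t, |Z (s + 1) - Z s| +
        ∑ s ∈ Finset.range t, max (|Z (s + 1) - Z s| - M) 0 := by
  set A : Set ℝ := (Set.Ioo (-d) d)ᶜ with hA
  -- Each message errs by at most φ plus its overshoot. The path was within d of the reference one
  -- step earlier, so the overshoot is at most the last increment: M of it is charged to the
  -- message, the rest to the excess sum. Summing the constant d gives d times the number of
  -- messages, hence the factor (φ + M) / d.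
  have key : |refLevel Z A t - Z 0 - sampledSum Z A (quantize d φ L) t| ≤
      (φ + M) / d * sampledSum Z A (fun _ => d) t +
        ∑ s ∈ Finset.range t, max (|Z (s + 1) - Z s| - M) 0 := by
    induction t with
    | zero => simp [sampledSum, refLevel]
    | succ t ih =>
      rw [sampledSum_succ, sampledSum_succ, Finset.sum_range_succ, refLevel]
      have h0 : (0 : ℝ) ≤ max (|Z (t + 1) - Z t| - M) 0 := le_max_right _ _
      have h0' : |Z (t + 1) - Z t| - M ≤ max (|Z (t + 1) - Z t| - M) 0 := le_max_left _ _
      split_ifs with h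
      · have h1 := abs_sub_quantize_le hd hφ hL (le_abs_of_mem h)
        have h2 : |Z (t + 1) - refLevel Z A t| ≤
          |Z (t + 1) - Z t| + |Z t - refLevel Z A t| := abs_sub_le _ _ _
        have h3 := abs_sub_refLevel_lt Z hd t
        have h4 : (φ + M) / d * d = φ + M := by field_simp
        rw [mul_add, h4]
        have h5 : Z (t + 1) - Z 0 - (sampledSum Z A (quantize d φ L) t +
            quantize d φ L (Z (t + 1) - refLevel Z A t)) =
            (refLevel Z A t - Z 0 - sampledSum Z A (quantize d φ L) t) +
            (Z (t + 1) - refLevel Z A t - quantize d φ L (Z (t + 1) - refLevel Z A t)) := by ring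
        rw [h5]
        refine (abs_add_le _ _).trans ?_
        linarith
      · rw [add_zero, add_zero]
        linarith
  have h1 := abs_sub_refLevel_lt Z hd t
  have h2 := sampledSum_const_le Z (d := d) t
  have h3 : sampledSum Z A (fun _ => d) t ≤ ∑ s ∈ Finset.range t, |Z (s + 1) - Z s| := by
    linarith [abs_nonneg (Z t - refLevel Z A t)]
  have h4 : (φ + M) / d * sampledSum Z A (fun _ => d) t ≤
      (φ + M) / d * ∑ s ∈ Finset.range t, |Z (s + 1) - Z s| := by
    gcongr
  have h5 : Z t - Z 0 - sampledSum Z A (quantize d φ L) t =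
    (Z t - refLevel Z A t) + (refLevel Z A t - Z 0 - sampledSum Z A (quantize d φ L) t) := by ring
  rw [h5]
  refine (abs_add_le _ _).trans ?_
  linarith

lemma abs_sampledSum_le (A : Set ℝ) {f : ℝ → ℝ} {C : ℝ} (hC : 0 ≤ C) (hf : ∀ v, |f v| ≤ C)
    (t : ℕ) : |sampledSum Z A f t| ≤ t * C := by
  refine (Finset.abs_sum_le_sum_abs _ _).trans ?_
  refine (Finset.sum_le_card_nsmul _ _ C fun s _ => ?_).trans (by simp)
  split_ifs
  · exact hf _
  · simpa using hC

variable {Z}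

lemma sampledSum_quantize_nonneg (hZ : Monotone Z) (hd : 0 < d) {φ : ℝ} (hφ : 0 < φ) (L t : ℕ) :
    0 ≤ sampledSum Z (Set.Ioo (-d) d)ᶜ (quantize d φ L) t := by
  refine Finset.sum_nonneg fun s _ => ?_
  split_ifs with h
  · have h1 : 0 ≤ Z (s + 1) - refLevel Z (Set.Ioo (-d) d)ᶜ s :=
      sub_nonneg.mpr ((refLevel_le_of_monotone _ hZ s).trans (hZ s.le_succ))
    have h2 := le_abs_of_mem h
    rw [abs_of_nonneg h1] at h2
    exact hd.le.trans (le_quantize hφ L (hd.trans_le h2))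
  · exact le_rfl

/-- The recovered value of a nondecreasing path grows with the sum of its capped increments. -/
lemma sum_min_le_sampledSum (hZ : Monotone Z) (hd : 0 < d) {φ : ℝ} (hφ : 0 < φ) (L t : ℕ) :
    ∑ s ∈ Finset.range t, min (Z (s + 1) - Z s) d ≤
      2 * sampledSum Z (Set.Ioo (-d) d)ᶜ (quantize d φ L) t + d := by
  set A : Set ℝ := (Set.Ioo (-d) d)ᶜ with hA
  -- The factor 2: at a sample, the capped increment and the discarded distance to the reference are
  -- each at most d, while the message adds at least d.
  have key : ∑ s ∈ Finset.range t, min (Z (s + 1) - Z s) d ≤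
      2 * sampledSum Z A (quantize d φ L) t + (Z t - refLevel Z A t) := by
    induction t with
    | zero => simp [sampledSum, refLevel]
    | succ t ih =>
      rw [sampledSum_succ, Finset.sum_range_succ, refLevel]
      have h1 : 0 ≤ Z (t + 1) - refLevel Z A t :=
        sub_nonneg.mpr ((refLevel_le_of_monotone _ hZ t).trans (hZ t.le_succ))
      have h3 := (le_abs_self _).trans (abs_sub_refLevel_lt Z hd t).le
      have h4 : min (Z (t + 1) - Z t) d ≤ d := min_le_right _ _
      have h5 : min (Z (t + 1) - Z t) d ≤ Z (t + 1) - Z t := min_le_left _ _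
      split_ifs with h
      · have h2 := le_abs_of_mem h
        rw [abs_of_nonneg h1] at h2
        have := le_quantize (d := d) hφ L (hd.trans_le h2)
        linarith
      · linarith
  linarith [(le_abs_self _).trans (abs_sub_refLevel_lt Z hd t).le]

end PathBounds

/-! ### Measurability of the sampling scheme -/

section Measurability

variable {α : Type*} [MeasurableSpace α]

lemma measurable_refLevel {Z : α → ℕ → ℝ} (hZ : ∀ t, Measurable fun a => Z a t) {A : Set ℝ}
    (hA : MeasurableSet A) (t : ℕ) : Measurable fun a => refLevel (Z a) A t := by
  induction t with
  | zero => simpa [refLevel] using hZ 0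
  | succ t ih => exact Measurable.ite (((hZ (t + 1)).sub ih) hA) (hZ (t + 1)) ih

lemma measurable_sampledSum {Z : α → ℕ → ℝ} (hZ : ∀ t, Measurable fun a => Z a t) {A : Set ℝ}
    (hA : MeasurableSet A) {f : ℝ → ℝ} (hf : Measurable f) (t : ℕ) :
    Measurable fun a => sampledSum (Z a) A f t := by
  refine Finset.measurable_fun_sum _ fun s _ => ?_
  have h := (hZ (s + 1)).sub (measurable_refLevel hZ hA s)
  exact Measurable.ite (h hA) (hf.comp h) measurable_const

lemma measurable_midRiser (c : ℝ) (L : ℕ) : Measurable (midRiser c L) := by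
  unfold midRiser
  have h1 : Measurable fun p : ℝ => ⌊p / (c / L)⌋₊ :=
    Nat.measurable_floor.comp (measurable_id.div_const _)
  have h2 : Measurable fun n : ℕ => (((min n (L - 1) : ℕ) : ℝ) + 1 / 2) * (c / L) :=
    measurable_from_top
  exact h2.comp h1

lemma measurable_quantize (d φ : ℝ) (L : ℕ) : Measurable (quantize d φ L) := by
  unfold quantize
  have h1 : Measurable Real.sign :=
    Measurable.ite measurableSet_Iio measurable_const
      (Measurable.ite measurableSet_Ioi measurable_const measurable_const)
  exact h1.mul (measurable_const.add
    ((measurable_midRiser φ L).comp ((measurable_id.abs).sub_const d)))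

lemma measurable_nat_sInf {S : α → Set ℕ} (hS : ∀ t, MeasurableSet {a | t ∈ S a}) :
    Measurable fun a => sInf (S a) := by
  classical
  refine measurable_to_countable' fun n => ?_
  -- The second piece accounts for the empty set, whose infimum in `ℕ` is 0.
  have h : (fun a => sInf (S a)) ⁻¹' {n} =
      ({a | n ∈ S a} ∩ ⋂ m ∈ Set.Iio n, {a | m ∈ S a}ᶜ) ∪
        ({_a | n = 0} ∩ ⋂ m, {a | m ∈ S a}ᶜ) := by
    ext a
    simp only [Set.mem_preimage, Set.mem_singleton_iff, Set.mem_union, Set.mem_inter_iff,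
      Set.mem_ofPred_eq, Set.mem_iInter, Set.mem_compl_iff, Set.mem_Iio]
    constructor
    · rintro rfl
      rcases (S a).eq_empty_or_nonempty with h | h
      · right
        simp [h]
      · exact Or.inl ⟨Nat.sInf_mem h, fun m hm => Nat.notMem_of_lt_sInf hm⟩
    · rintro (⟨h1, h2⟩ | ⟨rfl, h2⟩)
      · refine le_antisymm (Nat.sInf_le h1) ?_
        by_contra! hc
        exact h2 _ hc (Nat.sInf_mem ⟨n, h1⟩)
      · rw [Set.eq_empty_of_forall_notMem h2, Nat.sInf_empty]
  rw [h]
  refine ((hS n).inter ?_).union ((MeasurableSet.const _).inter ?_)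
  · exact MeasurableSet.biInter (Set.to_countable _) fun m _ => (hS m).compl
  · exact MeasurableSet.iInter fun m => (hS m).compl

lemma measurable_comp_nat {β : Type*} [MeasurableSpace β] {G : ℕ → α → β}
    (hG : ∀ n, Measurable (G n)) {N : α → ℕ} (hN : Measurable N) :
    Measurable fun a => G (N a) a := by
  have h : Measurable fun p : ℕ × α => G p.1 p.2 := measurable_from_prod_countable_right hG
  exact h.comp (hN.prodMk measurable_id)

variable {part : ℂ → ℝ}

lemma measurable_localU (s : ℝ) {g : α → ℕ → ℂ} (hg : ∀ t, Measurable fun a => g a t) (t : ℕ) :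
    Measurable fun a => localU s (g a) t := by
  unfold localU
  have := hg
  fun_prop

lemma measurable_localV (hp : Measurable part) (s : ℝ) {g y : α → ℕ → ℂ}
    (hg : ∀ t, Measurable fun a => g a t) (hy : ∀ t, Measurable fun a => y a t) (t : ℕ) :
    Measurable fun a => localV part s (g a) (y a) t := by
  unfold localV
  refine Finset.measurable_fun_sum _ fun τ _ => ?_
  refine ((hp.comp ?_).const_mul 2).div_const _
  exact (Complex.continuous_conj.measurable.comp (hg τ)).mul (hy τ)

end Measurability

/-! ### The local statistics depend only on the past -/

section LocalPaths

lemma localU_succ_sub (s : ℝ) (g : ℕ → ℂ) (t : ℕ) :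
    localU s g (t + 1) - localU s g t = 2 * ‖g t‖ ^ 2 / s ^ 2 := by
  simp [localU, Finset.sum_range_succ]

lemma localU_mono (s : ℝ) (g : ℕ → ℂ) : Monotone (localU s g) := by
  refine monotone_nat_of_le_succ fun t => ?_
  rw [← sub_nonneg, localU_succ_sub]
  positivity

lemma localU_congr (s : ℝ) {g g' : ℕ → ℂ} {t : ℕ} (h : ∀ τ < t, g τ = g' τ) :
    localU s g t = localU s g' t :=
  Finset.sum_congr rfl fun τ hτ => by rw [h τ (Finset.mem_range.mp hτ)]

lemma localV_congr (part : ℂ → ℝ) (s : ℝ) {g g' y y' : ℕ → ℂ} {t : ℕ} (h : ∀ τ < t, g τ = g' τ)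
    (hy : ∀ τ < t, y τ = y' τ) :
    localV part s g y t = localV part s g' y' t :=
  Finset.sum_congr rfl fun τ hτ => by
    rw [h τ (Finset.mem_range.mp hτ), hy τ (Finset.mem_range.mp hτ)]

lemma refLevel_congr {Z Z' : ℕ → ℝ} (A : Set ℝ) {t : ℕ} (h : ∀ s ≤ t, Z s = Z' s) :
    refLevel Z A t = refLevel Z' A t := by
  induction t with
  | zero => simpa [refLevel] using h 0
  | succ t ih =>
    rw [refLevel, refLevel, ih fun s hs => h s (hs.trans t.le_succ), h (t + 1) le_rfl]

lemma sampledSum_congr {Z Z' : ℕ → ℝ} (A : Set ℝ) (f : ℝ → ℝ) {t : ℕ} (h : ∀ s ≤ t, Z s = Z' s) :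
    sampledSum Z A f t = sampledSum Z' A f t := by
  refine Finset.sum_congr rfl fun s hs => ?_
  have hs' : s + 1 ≤ t := Finset.mem_range.mp hs
  rw [h (s + 1) hs', refLevel_congr A fun r hr => h r (by omega)]

end LocalPaths

/-! ### The fused statistics as functions of gains and noise -/

section Fused

variable {K : ℕ} {D : Design K} {part : ℂ → ℝ} {σ : Fin K → ℝ}

lemma fusedU_eq (he : ∀ k, 0 < D.e k) (g : Fin K → ℕ → ℂ) (t : ℕ) :
    fusedU D σ g t = ∑ k, sampledSum (localU (σ k) (g k)) (Set.Ioo (-D.e k) (D.e k))ᶜ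
      (quantize (D.e k) (D.θ k) (2 ^ D.rU)) t :=
  Finset.sum_congr rfl fun k _ => recoverU_eq (localU_mono _ _) (he k) _ _ _

lemma fusedV_eq (g y : Fin K → ℕ → ℂ) (t : ℕ) :
    fusedV D part σ g y t =
      ∑ k, sampledSum (localV part (σ k) (g k) (y k)) (Set.Ioo (-D.d k) (D.d k))ᶜ
        (quantize (D.d k) (D.φ k) (2 ^ (D.rV - 1))) t :=
  Finset.sum_congr rfl fun _ _ => recoverV_eq _ _ _ _ _

lemma fusedU_congr (he : ∀ k, 0 < D.e k) {g g' : Fin K → ℕ → ℂ} {t : ℕ}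
    (h : ∀ k, ∀ τ < t, g k τ = g' k τ) : fusedU D σ g t = fusedU D σ g' t := by
  rw [fusedU_eq he, fusedU_eq he]
  exact Finset.sum_congr rfl fun k _ => sampledSum_congr _ _ fun s hs =>
    localU_congr _ fun τ hτ => h k τ (hτ.trans_le hs)

lemma fusedV_congr {g g' y y' : Fin K → ℕ → ℂ} {t : ℕ}
    (h : ∀ k, ∀ τ < t, g k τ = g' k τ) (hy : ∀ k, ∀ τ < t, y k τ = y' k τ) :
    fusedV D part σ g y t = fusedV D part σ g' y' t := by
  rw [fusedV_eq, fusedV_eq]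
  exact Finset.sum_congr rfl fun k _ => sampledSum_congr _ _ fun s hs =>
    localV_congr _ _ (fun τ hτ => h k τ (hτ.trans_le hs)) (fun τ hτ => hy k τ (hτ.trans_le hs))

lemma abs_fusedV_le (hd : ∀ k, 0 < D.d k) (hφ : ∀ k, 0 < D.φ k) (g y : Fin K → ℕ → ℂ) (t : ℕ) :
    |fusedV D part σ g y t| ≤ t * ∑ k, (D.d k + D.φ k) := by
  rw [fusedV_eq, Finset.mul_sum]
  refine (Finset.abs_sum_le_sum_abs _ _).trans (Finset.sum_le_sum fun k _ => ?_)
  exact abs_sampledSum_le _ _ (add_pos (hd k) (hφ k)).le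
    (abs_quantize_le (hd k) (hφ k) (by positivity)) t

/-- The data of the gains up to time `t`. -/
noncomputable def mask (t : ℕ) (g : Fin K → ℕ → ℂ) : Fin K → ℕ → ℂ :=
  fun k τ => if τ < t then g k τ else 0

/-- The estimate as a function of a stopping time, the gains up to it, and the noise. -/
noncomputable def estimateOf (D : Design K) (part : ℂ → ℝ) (σ : Fin K → ℝ) (x : ℂ)
    (p : (ℕ × (Fin K → ℕ → ℂ)) × (Fin K × ℕ → ℂ)) : ℝ :=
  fusedV D part σ p.1.2 (fun k t => x * p.1.2 k t + p.2 (k, t)) p.1.1 / fusedU D σ p.1.2 p.1.1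

/-- Gains from time t on are never read, so the estimate is a function of the variable generating
`gainsUpTo` and of the noise. -/
lemma estimateOf_mask (he : ∀ k, 0 < D.e k) (x : ℂ) (t : ℕ) (g : Fin K → ℕ → ℂ)
    (v : Fin K × ℕ → ℂ) :
    estimateOf D part σ x ((t, mask t g), v) = estimateOf D part σ x ((t, g), v) := by
  have h : ∀ k, ∀ τ < t, mask t g k τ = g k τ := fun _ τ hτ => if_pos hτ
  unfold estimateOf
  rw [fusedU_congr he h]
  congr 1
  exact fusedV_congr h fun k τ hτ => by simp only [h k τ hτ]

variable {α : Type*} [MeasurableSpace α]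

lemma measurable_fusedU (he : ∀ k, 0 < D.e k) {g : α → Fin K → ℕ → ℂ}
    (hg : ∀ k t, Measurable fun a => g a k t) (t : ℕ) : Measurable fun a => fusedU D σ (g a) t := by
  simp only [fusedU_eq he]
  exact Finset.measurable_fun_sum _ fun k _ => measurable_sampledSum
    (measurable_localU _ (hg k)) measurableSet_Ioo.compl (measurable_quantize _ _ _) t

lemma measurable_fusedV (hp : Measurable part) {g y : α → Fin K → ℕ → ℂ}
    (hg : ∀ k t, Measurable fun a => g a k t) (hy : ∀ k t, Measurable fun a => y a k t) (t : ℕ) :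
    Measurable fun a => fusedV D part σ (g a) (y a) t := by
  simp only [fusedV_eq]
  exact Finset.measurable_fun_sum _ fun k _ => measurable_sampledSum
    (measurable_localV hp _ (hg k) (hy k)) measurableSet_Ioo.compl (measurable_quantize _ _ _) t

lemma measurable_stopTime (he : ∀ k, 0 < D.e k) (J : ℝ) {g : α → Fin K → ℕ → ℂ}
    (hg : ∀ k t, Measurable fun a => g a k t) : Measurable fun a => stopTime D σ J (g a) :=
  measurable_nat_sInf fun t => measurableSet_le measurable_const (measurable_fusedU he hg t)

lemma measurable_mask {N : α → ℕ} (hN : Measurable N) {g : α → Fin K → ℕ → ℂ}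
    (hg : ∀ k t, Measurable fun a => g a k t) : Measurable fun a => mask (N a) (g a) := by
  refine measurable_pi_lambda _ fun k => measurable_pi_lambda _ fun τ => ?_
  exact Measurable.ite (measurableSet_lt measurable_const hN) (hg k τ) measurable_const

lemma measurable_estimateOf (he : ∀ k, 0 < D.e k) (hp : Measurable part) (x : ℂ) :
    Measurable (estimateOf D part σ x) := by
  have hN : Measurable fun p : (ℕ × (Fin K → ℕ → ℂ)) × (Fin K × ℕ → ℂ) => p.1.1 := by fun_prop
  have hg : ∀ k t, Measurable fun p : (ℕ × (Fin K → ℕ → ℂ)) × (Fin K × ℕ → ℂ) => p.1.2 k t := by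
    intro k t; fun_prop
  have hw : ∀ k t, Measurable fun p : (ℕ × (Fin K → ℕ → ℂ)) × (Fin K × ℕ → ℂ) => p.2 (k, t) := by
    intro k t; fun_prop
  exact (measurable_comp_nat (fun n => measurable_fusedV (D := D) (σ := σ) hp hg
    (fun k t => ((hg k t).const_mul x).add (hw k t)) n) hN).div
    (measurable_comp_nat (fun n => measurable_fusedU he hg n) hN)

end Fused

/-! ### Exponential tails -/

section Tail

variable {Ω : Type*} [MeasurableSpace Ω] {P : Measure Ω} [IsProbabilityMeasure P]

/-- Partial sums of positive i.i.d. variables stay below a level with exponentially small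
probability. -/
lemma exists_measure_sum_le_le_geometric {X : ℕ → Ω → ℝ} (hX : ∀ n, Measurable (X n))
    (hindep : iIndepFun X P) (hident : ∀ n, IdentDistrib (X n) (X 0) P P)
    (hnn : ∀ n ω, 0 ≤ X n ω) (hpos : ∀ᵐ ω ∂P, 0 < X 0 ω) (B : ℝ) :
    ∃ C ρ : ℝ, 0 ≤ ρ ∧ ρ < 1 ∧
      ∀ t : ℕ, P.real {ω | ∑ s ∈ Finset.range t, X s ω ≤ B} ≤ C * ρ ^ t := by
  have hint : Integrable (fun ω => Real.exp (-1 * X 0 ω)) P := by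
    refine Integrable.of_bound (by have := hX 0; fun_prop) 1 (ae_of_all _ fun ω => ?_)
    rw [Real.norm_eq_abs, Real.abs_exp, Real.exp_le_one_iff]
    linarith [hnn 0 ω]
  -- Chernoff's bound at parameter -1; the ratio E exp(-X₀) is below 1 because X₀ is almost surely
  -- positive.
  refine ⟨Real.exp B, mgf (X 0) P (-1), mgf_nonneg, ?_, fun t => ?_⟩
  · have h1 : 0 < ∫ ω, (1 - Real.exp (-1 * X 0 ω)) ∂P := by
      rw [integral_pos_iff_support_of_nonneg_ae]
      · have h2 : Function.support (fun ω => 1 - Real.exp (-1 * X 0 ω)) =ᵐ[P] Set.univ := by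
          filter_upwards [hpos] with ω hω
          refine propext ⟨fun _ => trivial, fun _ => ?_⟩
          have : Real.exp (-1 * X 0 ω) < 1 :=
            (Real.exp_lt_exp.mpr (by linarith)).trans_eq Real.exp_zero
          exact (sub_pos.mpr this).ne'
        rw [measure_congr h2]
        simp
      · refine ae_of_all _ fun ω => ?_
        simp only [Pi.zero_apply, sub_nonneg, Real.exp_le_one_iff]
        linarith [hnn 0 ω]
      · exact (integrable_const _).sub hint
    rw [integral_sub (integrable_const _) hint] at h1
    simp only [integral_const, probReal_univ, smul_eq_mul, mul_one] at h1
    rw [mgf]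
    linarith
  · have h2 := measure_le_le_exp_mul_mgf (μ := P) (X := ∑ s ∈ Finset.range t, X s) (t := -1) B
      (by norm_num) ?_
    · rw [hindep.mgf_sum hX, Finset.prod_congr rfl fun i _ =>
        (mgf_congr_of_identDistrib (X i) (X 0) (hident i) (-1))] at h2
      simpa using h2
    · refine Integrable.of_bound (by have := hX; fun_prop) 1 (ae_of_all _ fun ω => ?_)
      rw [Real.norm_eq_abs, Real.abs_exp, Real.exp_le_one_iff, Finset.sum_apply]
      linarith [Finset.sum_nonneg fun s (_ : s ∈ Finset.range t) => hnn s ω]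

/-- T is the sum over t of the indicators of {t < T}, and the tail probabilities are summable. -/
lemma integrable_nat_of_tail_le {T : Ω → ℕ} (hT : Measurable T) {C ρ : ℝ}
    (hρ : 0 ≤ ρ) (hρ1 : ρ < 1) (h : ∀ t : ℕ, P.real {ω | t < T ω} ≤ C * ρ ^ t) :
    Integrable (fun ω => (T ω : ℝ)) P := by
  have hmeas : Measurable fun ω => (T ω : ℝ) := measurable_from_top.comp hT
  refine ⟨hmeas.aestronglyMeasurable, ?_⟩
  have h1 : ∀ ω, ‖(T ω : ℝ)‖ₑ = ∑' t : ℕ, {ω' | t < T ω'}.indicator (1 : Ω → ENNReal) ω := by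
    intro ω
    rw [tsum_eq_sum (s := Finset.range (T ω))]
    · rw [Finset.sum_congr rfl (g := fun _ => (1 : ENNReal))]
      · simp
      · intro t ht
        rw [Set.indicator_of_mem (show ω ∈ {ω' | t < T ω'} from Finset.mem_range.mp ht),
          Pi.one_apply]
    · intro t ht
      have ht' : ω ∉ {ω' | t < T ω'} := fun h => ht (Finset.mem_range.mpr h)
      exact Set.indicator_of_notMem ht' _
  have hset : ∀ t : ℕ, MeasurableSet {ω | t < T ω} := fun t =>
    measurableSet_lt measurable_const hT
  rw [hasFiniteIntegral_iff_enorm]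
  simp_rw [h1]
  rw [lintegral_tsum fun t => ((measurable_one.indicator (hset t)).aemeasurable)]
  simp_rw [lintegral_indicator_one (hset _)]
  have h2 : ∀ t : ℕ, P {ω | t < T ω} ≤ ENNReal.ofReal (C * ρ ^ t) := fun t => by
    rw [← ofReal_measureReal]
    exact ENNReal.ofReal_le_ofReal (h t)
  refine (ENNReal.tsum_le_tsum h2).trans_lt ?_
  exact ((summable_geometric_of_lt_one hρ hρ1).mul_left C).tsum_ofReal_lt_top

end Tail

/-! ### Almost sure stopping and integrability of the estimate -/

section Stopping

variable {K : ℕ} {D : Design K} {part : ℂ → ℝ} {σ : Fin K → ℝ}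

lemma lt_of_lt_stopTime {J : ℝ} {g : Fin K → ℕ → ℂ} {t : ℕ} (h : t < stopTime D σ J g) :
    fusedU D σ g t < J := by
  by_contra! hc
  exact absurd (Nat.sInf_le (s := {t : ℕ | J ≤ fusedU D σ g t}) hc) (not_le.mpr h)

lemma le_fusedU_stopTime {J : ℝ} {g : Fin K → ℕ → ℂ} (h : ∃ t, J ≤ fusedU D σ g t) :
    J ≤ fusedU D σ g (stopTime D σ J g) :=
  Nat.sInf_mem (s := {t : ℕ | J ≤ fusedU D σ g t}) h

lemma sum_min_le_fusedU (he : ∀ k, 0 < D.e k) (hθ : ∀ k, 0 < D.θ k) (g : Fin K → ℕ → ℂ)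
    (k : Fin K) (t : ℕ) :
    ∑ s ∈ Finset.range t, min (2 * ‖g k s‖ ^ 2 / σ k ^ 2) (D.e k) ≤
      2 * fusedU D σ g t + D.e k := by
  have h1 := sum_min_le_sampledSum (localU_mono (σ k) (g k)) (he k) (hθ k) (2 ^ D.rU) t
  simp only [localU_succ_sub] at h1
  have h2 : sampledSum (localU (σ k) (g k)) (Set.Ioo (-D.e k) (D.e k))ᶜ
      (quantize (D.e k) (D.θ k) (2 ^ D.rU)) t ≤ fusedU D σ g t := by
    rw [fusedU_eq he]
    exact Finset.single_le_sum (f := fun k => sampledSum (localU (σ k) (g k))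
      (Set.Ioo (-D.e k) (D.e k))ᶜ (quantize (D.e k) (D.θ k) (2 ^ D.rU)) t)
      (fun k _ => sampledSum_quantize_nonneg (localU_mono _ _) (he k) (hθ k) _ _)
      (Finset.mem_univ k)
  linarith

/-- Each sensor sends at most one message on V per instant, of size at most d + φ, and the
denominator is at least J. Integrability thus passes from the stopping time to the estimate. -/
lemma abs_estimate_le (hd : ∀ k, 0 < D.d k) (hφ : ∀ k, 0 < D.φ k) {J : ℝ} (hJ : 0 < J)
    (g y : Fin K → ℕ → ℂ) :
    |estimate D part σ J g y| ≤ stopTime D σ J g * ((∑ k, (D.d k + D.φ k)) / J) := by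
  have h1 := abs_fusedV_le (part := part) (σ := σ) hd hφ g y (stopTime D σ J g)
  have h0 : 0 ≤ ∑ k, (D.d k + D.φ k) := Finset.sum_nonneg fun k _ => (add_pos (hd k) (hφ k)).le
  rw [estimate, abs_div, ← mul_div_assoc]
  -- The value 0 includes the default when the target is never reached; the numerator vanishes
  -- there. A positive infimum shows that the target is reached.
  rcases Nat.eq_zero_or_pos (stopTime D σ J g) with h | h
  · rw [h] at h1 ⊢
    simp only [Nat.cast_zero, zero_mul] at h1 ⊢
    rw [abs_eq_zero.mpr (abs_nonpos_iff.mp h1)]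
    simp
  · have h2 : J ≤ fusedU D σ g (stopTime D σ J g) :=
      le_fusedU_stopTime (Nat.nonempty_of_pos_sInf h)
    gcongr
    exact h2.trans (le_abs_self _)

variable {Ω : Type*} [MeasurableSpace Ω] {P : Measure Ω} [IsProbabilityMeasure P]
  {h : Fin K → ℕ → Ω → ℂ}

/-- One sensor suffices: below the target J, the i.i.d. positive increments of its U, capped at e,
sum to at most 2J + e. -/
lemma exists_measure_fusedU_lt_le_geometric (hσ : ∀ k, 0 < σ k)
    (he : ∀ k, 0 < D.e k) (hθ : ∀ k, 0 < D.θ k) (k : Fin K)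
    (hh_meas : ∀ k t, Measurable (h k t)) (hh_indep : iIndepFun (h k) P)
    (hh_ident : ∀ t, IdentDistrib (h k t) (h k 0) P P)
    (hh_ne : ∀ᵐ ω ∂P, h k 0 ω ≠ 0) (J : ℝ) :
    ∃ C ρ : ℝ, 0 ≤ ρ ∧ ρ < 1 ∧
      ∀ t : ℕ, P.real {ω | fusedU D σ (fun k t => h k t ω) t < J} ≤ C * ρ ^ t := by
  have hf : Measurable fun z : ℂ => min (2 * ‖z‖ ^ 2 / σ k ^ 2) (D.e k) := by fun_prop
  obtain ⟨C, ρ, hρ, hρ1, hb⟩ := exists_measure_sum_le_le_geometric (P := P)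
    (X := fun s ω => min (2 * ‖h k s ω‖ ^ 2 / σ k ^ 2) (D.e k))
    (fun n => hf.comp (hh_meas k n)) (hh_indep.comp _ fun _ => hf)
    (fun n => (hh_ident n).comp hf)
    (fun n ω => le_min (by positivity) (he k).le) (by
      filter_upwards [hh_ne] with ω hω
      refine lt_min ?_ (he k)
      have := hσ k
      have := norm_pos_iff.mpr hω
      positivity) (2 * J + D.e k)
  refine ⟨C, ρ, hρ, hρ1, fun t => (measureReal_mono fun ω hω => ?_).trans (hb t)⟩
  have := sum_min_le_fusedU (σ := σ) he hθ (fun k t => h k t ω) k t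
  have hω' : fusedU D σ (fun k t => h k t ω) t < J := hω
  exact this.trans (by linarith)

lemma ae_exists_le_fusedU {C ρ J : ℝ} (hρ : 0 ≤ ρ) (hρ1 : ρ < 1)
    (hb : ∀ t : ℕ, P.real {ω | fusedU D σ (fun k t => h k t ω) t < J} ≤ C * ρ ^ t) :
    ∀ᵐ ω ∂P, ∃ t, J ≤ fusedU D σ (fun k t => h k t ω) t := by
  have h1 : P.real {ω | ¬ ∃ t, J ≤ fusedU D σ (fun k t => h k t ω) t} ≤ 0 := by
    have h2 : Tendsto (fun t : ℕ => C * ρ ^ t) atTop (𝓝 (C * 0)) :=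
      (tendsto_pow_atTop_nhds_zero_of_lt_one hρ hρ1).const_mul C
    rw [mul_zero] at h2
    refine ge_of_tendsto' h2 fun t => (measureReal_mono fun ω hω => ?_).trans (hb t)
    have hω' : ¬ ∃ t, J ≤ fusedU D σ (fun k t => h k t ω) t := hω
    push Not at hω'
    exact hω' t
  rw [ae_iff]
  exact (measureReal_eq_zero_iff).mp (le_antisymm h1 measureReal_nonneg)

lemma measurable_estimate (he : ∀ k, 0 < D.e k) (hp : Measurable part) (J : ℝ) (x : ℂ)
    (hh_meas : ∀ k t, Measurable (h k t)) {w : Fin K → ℕ → Ω → ℂ}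
    (hw_meas : ∀ k t, Measurable (w k t)) :
    Measurable fun ω => estimate D part σ J (fun k t => h k t ω)
      (fun k t => x * h k t ω + w k t ω) := by
  have hT : Measurable fun ω => stopTime D σ J (fun k t => h k t ω) :=
    measurable_stopTime he J hh_meas
  have h1 := (measurable_estimateOf (σ := σ) he hp x).comp
    ((hT.prodMk (measurable_pi_lambda _ fun k => measurable_pi_lambda _ (hh_meas k))).prodMk
      (measurable_pi_lambda (fun ω (i : Fin K × ℕ) => w i.1 i.2 ω) fun i => hw_meas i.1 i.2))
  exact h1

lemma integrable_estimate (he : ∀ k, 0 < D.e k) (hd : ∀ k, 0 < D.d k) (hφ : ∀ k, 0 < D.φ k)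
    (hp : Measurable part) {J : ℝ} (hJ : 0 < J) (x : ℂ)
    (hh_meas : ∀ k t, Measurable (h k t)) {w : Fin K → ℕ → Ω → ℂ}
    (hw_meas : ∀ k t, Measurable (w k t)) {C ρ : ℝ} (hρ : 0 ≤ ρ) (hρ1 : ρ < 1)
    (hb : ∀ t : ℕ, P.real {ω | fusedU D σ (fun k t => h k t ω) t < J} ≤ C * ρ ^ t) :
    Integrable (fun ω => estimate D part σ J (fun k t => h k t ω)
      (fun k t => x * h k t ω + w k t ω)) P := by
  have hT : Measurable fun ω => stopTime D σ J (fun k t => h k t ω) :=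
    measurable_stopTime he J hh_meas
  have hTint := integrable_nat_of_tail_le (P := P) hT hρ hρ1 fun t =>
    (measureReal_mono fun ω hω => lt_of_lt_stopTime hω).trans (hb t)
  exact Integrable.mono' (hTint.mul_const ((∑ k, (D.d k + D.φ k)) / J))
    (measurable_estimate he hp J x hh_meas hw_meas).aestronglyMeasurable
    (ae_of_all _ fun ω => abs_estimate_le hd hφ hJ _ _)

end Stopping

/-! ### Moments of linear forms in a complex Gaussian -/

section ComplexGaussian

lemma integral_sq_gaussianReal_zero (v : NNReal) : ∫ x, x ^ 2 ∂gaussianReal 0 v = v := by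
  have h := variance_id_gaussianReal (μ := 0) (v := v)
  rw [variance_of_integral_eq_zero aemeasurable_id (by simp)] at h
  simpa using h

variable {Ω : Type*} [MeasurableSpace Ω] {P : Measure Ω} {w : Ω → ℂ} {s : ℝ}

lemma memLp_linear_complexGaussian (hw : Measurable w) (hlaw : P.map w = complexGaussian s)
    (α β : ℝ) : MemLp (fun ω => α * (w ω).re + β * (w ω).im) 2 P := by
  have hm : Measurable fun p : ℝ × ℝ => (⟨p.1, p.2⟩ : ℂ) :=
    Complex.measurableEquivRealProd.symm.measurable
  have hf : Measurable fun z : ℂ => α * z.re + β * z.im := by fun_prop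
  have h1 : MemLp (fun z : ℂ => α * z.re + β * z.im) 2 (P.map w) := by
    rw [hlaw, complexGaussian, memLp_map_measure_iff hf.aestronglyMeasurable hm.aemeasurable]
    have h2 := memLp_id_gaussianReal' (μ := 0) (v := Real.toNNReal (s ^ 2 / 2)) 2 (by simp)
    exact ((h2.comp_fst _).const_mul α).add ((h2.comp_snd _).const_mul β)
  exact (memLp_map_measure_iff hf.aestronglyMeasurable hw.aemeasurable).mp h1

lemma integral_comp_complexGaussian (hw : Measurable w) (hlaw : P.map w = complexGaussian s)
    {f : ℂ → ℝ} (hf : Measurable f) :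
    ∫ ω, f (w ω) ∂P = ∫ p : ℝ × ℝ, f ⟨p.1, p.2⟩ ∂((gaussianReal 0 (Real.toNNReal (s ^ 2 / 2))).prod
      (gaussianReal 0 (Real.toNNReal (s ^ 2 / 2)))) := by
  have hm : Measurable fun p : ℝ × ℝ => (⟨p.1, p.2⟩ : ℂ) :=
    Complex.measurableEquivRealProd.symm.measurable
  rw [← integral_map hw.aemeasurable hf.aestronglyMeasurable, hlaw, complexGaussian,
    integral_map hm.aemeasurable hf.aestronglyMeasurable]

lemma integral_linear_complexGaussian (hw : Measurable w) (hlaw : P.map w = complexGaussian s)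
    (α β : ℝ) : ∫ ω, (α * (w ω).re + β * (w ω).im) ∂P = 0 := by
  rw [integral_comp_complexGaussian hw hlaw (f := fun z => α * z.re + β * z.im) (by fun_prop)]
  have h2 : Integrable id (gaussianReal 0 (Real.toNNReal (s ^ 2 / 2))) :=
    (memLp_id_gaussianReal' 1 (by simp)).integrable le_rfl
  have h3 := h2.comp_fst (gaussianReal 0 (Real.toNNReal (s ^ 2 / 2)))
  have h4 := h2.comp_snd (gaussianReal 0 (Real.toNNReal (s ^ 2 / 2)))
  simp only [id] at h3 h4
  rw [integral_add (h3.const_mul α) (h4.const_mul β), integral_const_mul, integral_const_mul,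
    integral_fun_fst (fun x => x), integral_fun_snd (fun x => x)]
  simp

lemma integral_linear_sq_complexGaussian (hw : Measurable w) (hlaw : P.map w = complexGaussian s)
    (α β : ℝ) :
    ∫ ω, (α * (w ω).re + β * (w ω).im) ^ 2 ∂P = (α ^ 2 + β ^ 2) * (s ^ 2 / 2) := by
  rw [integral_comp_complexGaussian hw hlaw (f := fun z => (α * z.re + β * z.im) ^ 2)
    (by fun_prop)]
  set γ := gaussianReal 0 (Real.toNNReal (s ^ 2 / 2)) with hγ
  have h1 : Integrable (fun x : ℝ => x) γ :=
    (memLp_id_gaussianReal' 1 (by simp)).integrable le_rfl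
  have h2 : Integrable (fun x : ℝ => x ^ 2) γ :=
    (memLp_id_gaussianReal' 2 (by simp)).integrable_sq
  have h3 := h2.comp_fst γ
  have h4 := h2.comp_snd γ
  have h5 : Integrable (fun p : ℝ × ℝ => p.1 * p.2) (γ.prod γ) := h1.mul_prod h1
  have h6 : ∀ p : ℝ × ℝ, (α * p.1 + β * p.2) ^ 2 =
    α ^ 2 * p.1 ^ 2 + β ^ 2 * p.2 ^ 2 + 2 * α * β * (p.1 * p.2) := fun p => by ring
  simp only [h6]
  have h7 : Integrable (fun p : ℝ × ℝ => α ^ 2 * p.1 ^ 2 + β ^ 2 * p.2 ^ 2) (γ.prod γ) :=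
    (h3.const_mul _).add (h4.const_mul _)
  rw [integral_add h7 (h5.const_mul _),
    integral_add (h3.const_mul _) (h4.const_mul _), integral_const_mul, integral_const_mul,
    integral_const_mul, integral_fun_fst (fun x => x ^ 2), integral_fun_snd (fun x => x ^ 2),
    integral_prod_mul (fun x => x) (fun x => x), hγ, integral_sq_gaussianReal_zero]
  simp
  rw [max_eq_left (by positivity)]
  ring

end ComplexGaussian

/-! ### Drift and noise in the statistic V -/

section Noise

/-- The increment of the statistic `V` that is due to the noise `v`. -/
noncomputable def noiseStep (part : ℂ → ℝ) (s : ℝ) (g v : ℂ) : ℝ := 2 * part (conj g * v) / s ^ 2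

variable {part : ℂ → ℝ}

lemma measurable_of_re_or_im (hp : part = Complex.re ∨ part = Complex.im) : Measurable part := by
  rcases hp with rfl | rfl <;> fun_prop

/-- Multiplication by the conjugate of g is a rotation scaled by the modulus, so the noise moments
can be computed for real and imaginary parts at once. -/
lemma exists_part_mul_eq (hp : part = Complex.re ∨ part = Complex.im) (g : ℂ) :
    ∃ α β : ℝ, α ^ 2 + β ^ 2 = ‖g‖ ^ 2 ∧ ∀ v : ℂ, part (conj g * v) = α * v.re + β * v.im := by
  rw [← Complex.normSq_eq_norm_sq, Complex.normSq_apply]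
  rcases hp with rfl | rfl
  · exact ⟨g.re, g.im, by ring, fun v => by simp⟩
  · exact ⟨-g.im, g.re, by ring, fun v => by simp; ring⟩

/-- Since conj(g) · x g = x |g|², the drift of V is the parameter times the increment of U. -/
lemma localV_succ_sub (hp : part = Complex.re ∨ part = Complex.im) (s : ℝ) (g v : ℕ → ℂ) (x : ℂ)
    (t : ℕ) :
    localV part s g (fun τ => x * g τ + v τ) (t + 1) - localV part s g (fun τ => x * g τ + v τ) t =
      part x * (2 * ‖g t‖ ^ 2 / s ^ 2) + noiseStep part s (g t) (v t) := by
  rw [localV, localV, Finset.sum_range_succ, add_sub_cancel_left, noiseStep,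
    ← Complex.normSq_eq_norm_sq, Complex.normSq_apply]
  rcases hp with rfl | rfl <;> simp <;> ring

variable {Ω : Type*} [MeasurableSpace Ω] {P : Measure Ω} {w : Ω → ℂ} {s : ℝ}

lemma measurable_noiseStep (hp : Measurable part) (s : ℝ) (g : ℂ) :
    Measurable (noiseStep part s g) := by
  unfold noiseStep
  exact ((hp.comp (measurable_const.mul measurable_id)).const_mul 2).div_const _

/-- The noise variance equals the increment of U: (2 / s²)² · |g|² · s² / 2 = 2 |g|² / s². -/
lemma noiseStep_moments (hp : part = Complex.re ∨ part = Complex.im) (hs : 0 < s)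
    (hw : Measurable w) (hlaw : P.map w = complexGaussian s) (g : ℂ) :
    MemLp (fun ω => noiseStep part s g (w ω)) 2 P ∧ ∫ ω, noiseStep part s g (w ω) ∂P = 0 ∧
      ∫ ω, noiseStep part s g (w ω) ^ 2 ∂P = 2 * ‖g‖ ^ 2 / s ^ 2 := by
  obtain ⟨α, β, hαβ, h⟩ := exists_part_mul_eq hp g
  have h1 : ∀ v, noiseStep part s g v = (2 / s ^ 2) * (α * v.re + β * v.im) := fun v => by
    rw [noiseStep, h]; ring
  simp only [h1, mul_pow]
  refine ⟨(memLp_linear_complexGaussian hw hlaw α β).const_mul _, ?_, ?_⟩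
  · rw [integral_const_mul, integral_linear_complexGaussian hw hlaw, mul_zero]
  · rw [integral_const_mul, integral_linear_sq_complexGaussian hw hlaw, hαβ]
    field_simp

variable [IsProbabilityMeasure P] {v : ℕ → Ω → ℂ}

lemma integral_sum_noiseStep_sq (hp : part = Complex.re ∨ part = Complex.im) (hs : 0 < s)
    (hv : ∀ t, Measurable (v t)) (hlaw : ∀ t, P.map (v t) = complexGaussian s)
    (hindep : iIndepFun v P) (g : ℕ → ℂ) (t : ℕ) :
    MemLp (fun ω => ∑ τ ∈ Finset.range t, noiseStep part s (g τ) (v τ ω)) 2 P ∧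
      ∫ ω, (∑ τ ∈ Finset.range t, noiseStep part s (g τ) (v τ ω)) ^ 2 ∂P = localU s g t := by
  have hm := fun τ => noiseStep_moments hp hs (hv τ) (hlaw τ) (g τ)
  have hL : MemLp (fun ω => ∑ τ ∈ Finset.range t, noiseStep part s (g τ) (v τ ω)) 2 P :=
    memLp_finsetSum _ fun τ _ => (hm τ).1
  refine ⟨hL, ?_⟩
  have h0 : ∫ ω, ∑ τ ∈ Finset.range t, noiseStep part s (g τ) (v τ ω) ∂P = 0 := by
    rw [integral_finsetSum _ fun τ _ => (hm τ).1.integrable one_le_two]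
    exact Finset.sum_eq_zero fun τ _ => (hm τ).2.1
  rw [← variance_of_integral_eq_zero hL.aestronglyMeasurable.aemeasurable h0]
  have h1 := IndepFun.variance_sum (μ := P) (X := fun τ ω => noiseStep part s (g τ) (v τ ω))
    (s := Finset.range t) (fun τ _ => (hm τ).1) (fun i _ j _ hij =>
      (hindep.indepFun hij).comp (measurable_noiseStep (measurable_of_re_or_im hp) s (g i))
        (measurable_noiseStep (measurable_of_re_or_im hp) s (g j)))
  have h2 : (∑ τ ∈ Finset.range t, fun ω => noiseStep part s (g τ) (v τ ω)) =
    fun ω => ∑ τ ∈ Finset.range t, noiseStep part s (g τ) (v τ ω) := by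
    ext ω; simp
  rw [h2] at h1
  rw [h1, localU]
  refine Finset.sum_congr rfl fun τ _ => ?_
  rw [variance_of_integral_eq_zero (hm τ).1.aestronglyMeasurable.aemeasurable (hm τ).2.1,
    (hm τ).2.2]

end Noise

/-! ### Mean recovery error of one sensor, given its gains -/

section RecoveryError

/-- A bound for the mean error of the recovered path `V` of one sensor, given its gains, in terms of
the increments `z` of `U`; it also dominates the error of the recovered path `U`. -/
noncomputable def errorBound (b d φ M : ℝ) (z : ℕ → ℝ) (t : ℕ) : ℝ :=
  d + (φ + (b + 1) * M) / d * ((b + 1) * ∑ s ∈ Finset.range t, z s + t) +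
    b * ∑ s ∈ Finset.range t, max (z s - M) 0 + (∑ s ∈ Finset.range t, z s) / M + (t + 1) / M +
    M * (∑ s ∈ Finset.range t, z s) / (t + 1)

/-- The noise q and its sum W are traded for their squares by |q| ≤ 1 + q², |q| - M ≤ q² / M and |W|
≤ c + W² / c, so second moments suffice after integration. The cut level (|a| + 1) M allots |a| M to
the drift and M to the noise. -/
lemma abs_sub_recovered_le {Z z q : ℕ → ℝ} {a d φ M c : ℝ} (hz : ∀ s, 0 ≤ z s) (hd : 0 < d)
    (hφ : 0 < φ) {L : ℕ} (hL : 0 < L) (hM : 0 < M) (hc : 0 < c)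
    (hZ : ∀ s, Z (s + 1) - Z s = a * z s + q s) (t : ℕ) :
    |sampledSum Z (Set.Ioo (-d) d)ᶜ (quantize d φ L) t - a * ∑ s ∈ Finset.range t, z s| ≤
      d + (φ + (|a| + 1) * M) / d * (|a| * ∑ s ∈ Finset.range t, z s + (t +
        ∑ s ∈ Finset.range t, q s ^ 2)) +
      (|a| * ∑ s ∈ Finset.range t, max (z s - M) 0 + (∑ s ∈ Finset.range t, q s ^ 2) / M) +
      (c + (∑ s ∈ Finset.range t, q s) ^ 2 / c) := by
  have hM' : 0 ≤ (|a| + 1) * M := by positivity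
  have h1 := abs_sub_sampledSum_le Z hd hφ hL hM' t
  have h2 : Z t - Z 0 = a * ∑ s ∈ Finset.range t, z s + ∑ s ∈ Finset.range t, q s := by
    rw [← Finset.sum_range_sub, Finset.mul_sum, ← Finset.sum_add_distrib]
    exact Finset.sum_congr rfl fun s _ => hZ s
  rw [h2] at h1
  have h3 : ∑ s ∈ Finset.range t, |Z (s + 1) - Z s| ≤
      |a| * ∑ s ∈ Finset.range t, z s + (t + ∑ s ∈ Finset.range t, q s ^ 2) := by
    have : (t : ℝ) = ∑ s ∈ Finset.range t, (1 : ℝ) := by simp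
    rw [this, Finset.mul_sum, ← Finset.sum_add_distrib, ← Finset.sum_add_distrib]
    refine Finset.sum_le_sum fun s _ => ?_
    rw [hZ]
    refine (abs_add_le _ _).trans ?_
    rw [abs_mul, abs_of_nonneg (hz s), ← sq_abs (q s)]
    nlinarith [sq_nonneg (|q s| - 1), abs_nonneg (q s)]
  have h4 : ∑ s ∈ Finset.range t, max (|Z (s + 1) - Z s| - (|a| + 1) * M) 0 ≤
      |a| * ∑ s ∈ Finset.range t, max (z s - M) 0 + (∑ s ∈ Finset.range t, q s ^ 2) / M := by
    rw [Finset.mul_sum, Finset.sum_div, ← Finset.sum_add_distrib]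
    refine Finset.sum_le_sum fun s _ => max_le ?_ ?_
    · rw [hZ]
      have h5 : |a * z s + q s| ≤ |a| * z s + |q s| := by
        refine (abs_add_le _ _).trans ?_
        rw [abs_mul, abs_of_nonneg (hz s)]
      have h6 : |a| * (z s - M) ≤ |a| * max (z s - M) 0 := by
        gcongr
        exact le_max_left _ _
      have h7 : |q s| - M ≤ q s ^ 2 / M := by
        rw [le_div_iff₀ hM, ← sq_abs (q s)]
        nlinarith [sq_nonneg (|q s| - M), abs_nonneg (q s)]
      nlinarith
    · have : 0 ≤ max (z s - M) 0 := le_max_right _ _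
      positivity
  have h5 : |∑ s ∈ Finset.range t, q s| ≤ c + (∑ s ∈ Finset.range t, q s) ^ 2 / c := by
    generalize ∑ s ∈ Finset.range t, q s = W
    rw [← sub_le_iff_le_add', le_div_iff₀ hc, ← sq_abs W]
    nlinarith [sq_nonneg (|W| - c), abs_nonneg W]
  have h6 : (φ + (|a| + 1) * M) / d * ∑ s ∈ Finset.range t, |Z (s + 1) - Z s| ≤
      (φ + (|a| + 1) * M) / d *
        (|a| * ∑ s ∈ Finset.range t, z s + (t + ∑ s ∈ Finset.range t, q s ^ 2)) := by
    gcongr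
  have h7 : ∀ r : ℝ, |r - a * ∑ s ∈ Finset.range t, z s| ≤
      |a * ∑ s ∈ Finset.range t, z s + ∑ s ∈ Finset.range t, q s - r| +
        |∑ s ∈ Finset.range t, q s| := fun r => by
    rw [abs_sub_comm]
    have := abs_sub (a * ∑ s ∈ Finset.range t, z s + ∑ s ∈ Finset.range t, q s - r)
      (∑ s ∈ Finset.range t, q s)
    refine le_trans (le_of_eq ?_) this
    congr 1
    ring
  refine (h7 _).trans ?_
  linarith

lemma abs_sub_recovered_of_nonneg_le {Z z : ℕ → ℝ} {d φ M : ℝ} (hz : ∀ s, 0 ≤ z s) (hd : 0 < d)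
    (hφ : 0 < φ) {L : ℕ} (hL : 0 < L) (hM : 0 < M)
    (hZ : ∀ s, Z (s + 1) - Z s = z s) (t : ℕ) :
    |sampledSum Z (Set.Ioo (-d) d)ᶜ (quantize d φ L) t - ∑ s ∈ Finset.range t, z s| ≤
      errorBound 1 d φ M z t := by
  have h := abs_sub_sampledSum_le Z hd hφ hL hM.le t
  have h2 : Z t - Z 0 = ∑ s ∈ Finset.range t, z s := by
    rw [← Finset.sum_range_sub]
    exact Finset.sum_congr rfl fun s _ => hZ s
  rw [h2, abs_sub_comm] at h
  simp only [hZ, abs_of_nonneg (hz _)] at h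
  refine h.trans ?_
  have h0 : 0 ≤ ∑ s ∈ Finset.range t, z s := Finset.sum_nonneg fun s _ => hz s
  have h3 : (φ + M) / d * ∑ s ∈ Finset.range t, z s ≤
      (φ + (1 + 1) * M) / d * ((1 + 1) * ∑ s ∈ Finset.range t, z s + t) := by
    gcongr
    · linarith
    · have : (0 : ℝ) ≤ t := t.cast_nonneg
      linarith
  have h4 : 0 ≤ (∑ s ∈ Finset.range t, z s) / M + (t + 1) / M +
    M * (∑ s ∈ Finset.range t, z s) / (t + 1) := by positivity
  rw [errorBound]
  linarith

variable {part : ℂ → ℝ} {Ω : Type*} [MeasurableSpace Ω] {P : Measure Ω} [IsProbabilityMeasure P]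

lemma integral_abs_sub_recovered_le (hp : part = Complex.re ∨ part = Complex.im) {s : ℝ}
    (hs : 0 < s) {v : ℕ → Ω → ℂ}
    (hv : ∀ t, Measurable (v t)) (hlaw : ∀ t, P.map (v t) = complexGaussian s)
    (hindep : iIndepFun v P) (g : ℕ → ℂ) (x : ℂ) {d φ M : ℝ} (hd : 0 < d)
    (hφ : 0 < φ) {L : ℕ} (hL : 0 < L) (hM : 0 < M) (t : ℕ) :
    ∫ ω, |sampledSum (localV part s g (fun τ => x * g τ + v τ ω)) (Set.Ioo (-d) d)ᶜ
      (quantize d φ L) t - part x * localU s g t| ∂P ≤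
      errorBound |part x| d φ M (fun τ => 2 * ‖g τ‖ ^ 2 / s ^ 2) t := by
  set q : ℕ → Ω → ℝ := fun τ ω => noiseStep part s (g τ) (v τ ω) with hq
  have hm := fun τ => noiseStep_moments hp hs (hv τ) (hlaw τ) (g τ)
  obtain ⟨hW, hW2⟩ := integral_sum_noiseStep_sq hp hs hv hlaw hindep g t
  -- With c = (t + 1) / M, c is a small multiple of t + 1 for large M, while E W² / c = M U_t / (t +
  -- 1) stays bounded when U_t is linear in t.
  have hc : (0 : ℝ) < (t + 1) / M := by positivity
  have hb := fun ω => abs_sub_recovered_le (Z := localV part s g (fun τ => x * g τ + v τ ω))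
    (z := fun τ => 2 * ‖g τ‖ ^ 2 / s ^ 2) (q := fun τ => q τ ω) (a := part x)
    (fun τ => by positivity) hd hφ hL hM hc
    (fun τ => localV_succ_sub hp s g (fun τ => v τ ω) x τ) t
  have hQ : Integrable (fun ω => ∑ τ ∈ Finset.range t, q τ ω ^ 2) P :=
    integrable_finsetSum _ fun τ _ => (hm τ).1.integrable_sq
  have hQ' : ∫ ω, ∑ τ ∈ Finset.range t, q τ ω ^ 2 ∂P =
      ∑ τ ∈ Finset.range t, 2 * ‖g τ‖ ^ 2 / s ^ 2 := by
    rw [integral_finsetSum _ fun τ _ => (hm τ).1.integrable_sq]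
    exact Finset.sum_congr rfl fun τ _ => (hm τ).2.2
  have hWi := hW.integrable_sq
  have hU : localU s g t = ∑ τ ∈ Finset.range t, 2 * ‖g τ‖ ^ 2 / s ^ 2 := rfl
  set U := ∑ τ ∈ Finset.range t, 2 * ‖g τ‖ ^ 2 / s ^ 2
  set R := ∑ τ ∈ Finset.range t, max (2 * ‖g τ‖ ^ 2 / s ^ 2 - M) 0 with hR
  set κ := (φ + (|part x| + 1) * M) / d with hκ
  have hle := integral_mono_of_nonneg (ae_of_all P fun ω => abs_nonneg _)
    (((integrable_const (d + κ * (|part x| * U + t) + |part x| * R + (t + 1) / M)).add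
      (hQ.const_mul (κ + 1 / M))).add (hWi.const_mul (1 / ((t + 1) / M))))
    (ae_of_all P fun ω => (hb ω).trans (le_of_eq (by simp only [Pi.add_apply]; ring)))
  refine hle.trans (le_of_eq ?_)
  rw [integral_add' ((integrable_const _).add (hQ.const_mul _)) (hWi.const_mul _),
    integral_add' (integrable_const _) (hQ.const_mul _), integral_const_mul, integral_const_mul,
    hQ', hW2, hU, errorBound, ← hR, ← hκ]
  simp only [integral_const, probReal_univ, smul_eq_mul, one_mul]
  field_simp
  ring

end RecoveryError

/-! ### Regular gain paths and smallness of the error bound -/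

section RegularPaths

/-- The partial sums of `z` grow linearly, and the excess of `z` over a high level is negligible on
average. -/
structure RegularIncrements (z : ℕ → ℝ) : Prop where
  nonneg : ∀ s, 0 ≤ z s
  upper : ∃ B, 0 ≤ B ∧ ∀ t : ℕ, ∑ s ∈ Finset.range t, z s ≤ B * (t + 1)
  lower : ∃ μ C, 0 < μ ∧ ∀ t : ℕ, μ * t ≤ ∑ s ∈ Finset.range t, z s + C
  excess : ∀ δ > 0, ∃ M₀ > 0, ∀ M ≥ M₀, ∃ C, ∀ t : ℕ,
    ∑ s ∈ Finset.range t, max (z s - M) 0 ≤ δ * t + C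

/-- The constant C absorbs the finitely many early times; a bound for every t is needed because a
stopping time is inserted later. -/
lemma exists_abs_sub_mul_le {S : ℕ → ℝ} {μ : ℝ} (h : Tendsto (fun n : ℕ => S n / n) atTop (𝓝 μ))
    {δ : ℝ} (hδ : 0 < δ) : ∃ C, 0 ≤ C ∧ ∀ t : ℕ, |S t - μ * t| ≤ δ * t + C := by
  obtain ⟨t₀, ht₀⟩ := (Metric.tendsto_atTop.mp h) δ hδ
  refine ⟨∑ t ∈ Finset.range (t₀ + 1), |S t - μ * t|, by positivity, fun t => ?_⟩
  rcases lt_or_ge t (t₀ + 1) with ht | ht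
  · have h1 := Finset.single_le_sum (f := fun t : ℕ => |S t - μ * t|) (fun i _ => abs_nonneg _)
      (Finset.mem_range.mpr ht)
    have h2 : 0 ≤ δ * t := by positivity
    linarith
  · have h1 := ht₀ t (by omega)
    have h2 : (0 : ℝ) < t := by exact_mod_cast (by omega : 0 < t)
    have h3 : S t - μ * t = (S t / t - μ) * t := by field_simp
    rw [Real.dist_eq] at h1
    rw [h3, abs_mul, abs_of_pos h2]
    have h4 : |S t / t - μ| * t ≤ δ * t := by gcongr
    have h5 : 0 ≤ ∑ t ∈ Finset.range (t₀ + 1), |S t - μ * t| := by positivity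
    linarith

/-- The strong law for X gives linear growth. Applied to (X - M)⁺ for each natural M, it bounds the
excess, whose mean vanishes as M grows; real M follows by monotonicity. -/
lemma ae_regularIncrements {Ω : Type*} [MeasurableSpace Ω] {P : Measure Ω} [IsProbabilityMeasure P]
    {X : ℕ → Ω → ℝ} (hindep : iIndepFun X P)
    (hident : ∀ n, IdentDistrib (X n) (X 0) P P) (hint : Integrable (X 0) P)
    (hnn : ∀ n ω, 0 ≤ X n ω) (hpos : ∀ᵐ ω ∂P, 0 < X 0 ω) :
    ∀ᵐ ω ∂P, RegularIncrements fun n => X n ω := by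
  have hslln := strong_law_ae_real X hint (fun i j hij => hindep.indepFun hij) hident
  have hf : ∀ M : ℝ, Measurable fun x : ℝ => max (x - M) 0 := fun M => by fun_prop
  have hexint : ∀ M : ℕ, Integrable (fun ω => max (X 0 ω - M) 0) P := fun M =>
    (hint.sub (integrable_const _)).pos_part
  have hexc := fun M : ℕ => strong_law_ae_real (fun n ω => max (X n ω - M) 0) (hexint M)
    (fun i j hij => (hindep.indepFun hij).comp (hf M) (hf M))
    (fun n => (hident n).comp (hf M))
  have hμ : 0 < ∫ ω, X 0 ω ∂P := by
    rw [integral_pos_iff_support_of_nonneg_ae (ae_of_all _ (hnn 0)) hint]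
    have h2 : Function.support (X 0) =ᵐ[P] Set.univ := by
      filter_upwards [hpos] with ω hω
      exact propext ⟨fun _ => trivial, fun _ => hω.ne'⟩
    rw [measure_congr h2]
    simp
  have hρ : Tendsto (fun M : ℕ => ∫ ω, max (X 0 ω - M) 0 ∂P) atTop (𝓝 0) := by
    suffices h0 : Tendsto (fun M : ℕ => ∫ ω, max (X 0 ω - M) 0 ∂P) atTop
        (𝓝 (∫ _ω, (0 : ℝ) ∂P)) by simpa using h0
    refine tendsto_integral_of_dominated_convergence (X 0) (fun M => (hexint M).1) hint
      (fun M => ae_of_all _ fun ω => ?_) (ae_of_all _ fun ω => ?_)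
    · rw [Real.norm_eq_abs, abs_of_nonneg (le_max_right _ _)]
      exact max_le (by linarith [(M.cast_nonneg : (0 : ℝ) ≤ M)]) (hnn 0 ω)
    · obtain ⟨N, hN⟩ := exists_nat_ge (X 0 ω)
      refine tendsto_const_nhds.congr' ?_
      filter_upwards [eventually_ge_atTop N] with M hM
      have : (N : ℝ) ≤ M := by exact_mod_cast hM
      exact (max_eq_right (by linarith)).symm
  filter_upwards [hslln, ae_all_iff.mpr hexc] with ω h1 h2
  refine ⟨fun s => hnn s ω, ?_, ?_, fun δ hδ => ?_⟩
  · obtain ⟨C, hC, h3⟩ := exists_abs_sub_mul_le h1 one_pos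
    refine ⟨(∫ ω, X 0 ω ∂P) + 1 + C, by positivity, fun t => ?_⟩
    have h4 := (le_abs_self _).trans (h3 t)
    have h5 : (0 : ℝ) ≤ t := t.cast_nonneg
    nlinarith
  · obtain ⟨C, hC, h3⟩ := exists_abs_sub_mul_le h1 (half_pos hμ)
    refine ⟨(∫ ω, X 0 ω ∂P) / 2, C, half_pos hμ, fun t => ?_⟩
    have h4 := (neg_le_abs _).trans (h3 t)
    linarith
  · obtain ⟨N, hN⟩ := ((tendsto_order.mp hρ).2 (δ / 2) (half_pos hδ)).exists
    obtain ⟨C, hC, h3⟩ := exists_abs_sub_mul_le (h2 N) (half_pos hδ)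
    refine ⟨N + 1, by positivity, fun M hM => ⟨C, fun t => ?_⟩⟩
    have h4 := (le_abs_self _).trans (h3 t)
    have h5 : (∫ ω, max (X 0 ω - N) 0 ∂P) * t ≤ δ / 2 * t := by gcongr
    have h6 : ∑ s ∈ Finset.range t, max (X s ω - M) 0 ≤
        ∑ s ∈ Finset.range t, max (X s ω - N) 0 := by
      gcongr
      linarith
    linarith

/-- With thresholds of order `o(J)` tending to infinity, the recovery error is uniformly small. -/
lemma RegularIncrements.eventually_errorBound_le {z : ℕ → ℝ} (hz : RegularIncrements z) {b : ℝ}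
    (hb : 0 ≤ b) {d φ : ℝ → ℝ} (hd_top : Tendsto d atTop atTop)
    (hd : d =o[atTop] fun J : ℝ => J) (hφ_pos : ∀ J, 0 < φ J)
    (hφ : φ =O[atTop] fun _ => (1 : ℝ)) {δ : ℝ} (hδ : 0 < δ) :
    ∃ M > 0, ∀ᶠ J in atTop, ∀ t : ℕ, errorBound b (d J) (φ J) M z t ≤ δ * (J + t) := by
  obtain ⟨B, hB, hU⟩ := hz.upper
  obtain ⟨M₀, hM₀, hex⟩ := hz.excess (δ / (6 * (b + 1))) (by positivity)
  -- M is fixed before J: it makes the excess and the 1 / M terms at most δ / 6 per unit time. Only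
  -- then is J taken large, which kills (φ + (b + 1) M) / d and absorbs the constants.
  set M := max M₀ (6 * (B + 1) / δ) with hM
  have hMpos : 0 < M := hM₀.trans_le (le_max_left _ _)
  obtain ⟨C, hC⟩ := hex M (le_max_left _ _)
  refine ⟨M, hMpos, ?_⟩
  have hBM : (B + 1) / M ≤ δ / 6 := by
    have h1 : 6 * (B + 1) / δ ≤ M := le_max_right _ _
    rw [div_le_iff₀ hδ] at h1
    rw [div_le_div_iff₀ hMpos (by norm_num)]
    linarith
  have hκ : Tendsto (fun J => (φ J + (b + 1) * M) / d J * ((b + 1) * B + 1)) atTop (𝓝 0) := by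
    have h1 : (fun J => (φ J + (b + 1) * M) / d J) =O[atTop] fun J => (d J)⁻¹ := by
      have h2 : (fun J => φ J + (b + 1) * M) =O[atTop] fun _ => (1 : ℝ) :=
        hφ.add (isBigO_const_const _ one_ne_zero _)
      simpa [div_eq_mul_inv] using h2.mul (isBigO_refl (fun J => (d J)⁻¹) atTop)
    have h3 := (h1.trans_tendsto (tendsto_inv_atTop_zero.comp hd_top)).mul_const ((b + 1) * B + 1)
    simpa using h3
  have hκ' := (tendsto_order.mp hκ).2 (δ / 6) (by positivity)
  have hdJ := hd.bound (show 0 < δ / 6 by positivity)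
  have hJ := eventually_ge_atTop (6 / δ * (b * C + M * B + δ))
  filter_upwards [hκ', hdJ, hJ, eventually_ge_atTop (1 : ℝ),
    hd_top.eventually_gt_atTop 0] with J h1 h2 h3 h4 h5 t
  have ht : (0 : ℝ) ≤ t := t.cast_nonneg
  have hUt := hU t
  have hCt := hC t
  have hU0 : 0 ≤ ∑ s ∈ Finset.range t, z s := Finset.sum_nonneg fun s _ => hz.nonneg s
  rw [errorBound]
  generalize ∑ s ∈ Finset.range t, z s = U at *
  generalize ∑ s ∈ Finset.range t, max (z s - M) 0 = R at *
  have e1 : d J ≤ δ / 6 * J := by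
    rw [Real.norm_eq_abs, Real.norm_eq_abs, abs_of_pos h5, abs_of_pos (by linarith)] at h2
    exact h2
  have e2 : (φ J + (b + 1) * M) / d J * ((b + 1) * U + t) ≤ δ / 6 * (t + 1) := by
    have h6 : (b + 1) * U + t ≤ ((b + 1) * B + 1) * (t + 1) := by
      have : (b + 1) * U ≤ (b + 1) * (B * (t + 1)) := by gcongr
      linarith
    have h7 : 0 ≤ (φ J + (b + 1) * M) / d J := by
      have := hφ_pos J
      positivity
    calc _ ≤ (φ J + (b + 1) * M) / d J * (((b + 1) * B + 1) * (t + 1)) := by gcongr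
      _ = (φ J + (b + 1) * M) / d J * ((b + 1) * B + 1) * (t + 1) := by ring
      _ ≤ _ := by gcongr
  have e3 : b * R ≤ δ / 6 * t + b * C := by
    have : b * (δ / (6 * (b + 1))) ≤ δ / 6 := by
      rw [← mul_div_assoc, div_le_div_iff₀ (by positivity) (by norm_num)]
      nlinarith
    have h6 : b * (δ / (6 * (b + 1))) * t ≤ δ / 6 * t := by gcongr
    have h7 : b * R ≤ b * (δ / (6 * (b + 1)) * t + C) := by gcongr
    linarith
  have e4 : U / M + (t + 1) / M ≤ δ / 6 * (t + 1) := by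
    calc U / M + (t + 1) / M ≤ B * (t + 1) / M + (t + 1) / M := by gcongr
      _ = (B + 1) / M * (t + 1) := by ring
      _ ≤ _ := by gcongr
  have e5 : M * U / (t + 1) ≤ M * B := by
    rw [div_le_iff₀ (by positivity)]
    nlinarith
  have e6 : b * C + M * B + δ ≤ δ / 6 * J := by
    rw [div_mul_eq_mul_div, div_le_iff₀ hδ] at h3
    linarith
  nlinarith [mul_nonneg hδ.le ht]

end RegularPaths

/-- A family of designs, indexed by the target, with thresholds that tend to infinity at slower
rates than the target, and bounded quantizer ranges. -/
structure Admissible {K : ℕ} (D : ℝ → Design K) : Prop where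
  θ_pos : ∀ J k, 0 < (D J).θ k
  φ_pos : ∀ J k, 0 < (D J).φ k
  θ_bdd : ∀ k, (fun J => (D J).θ k) =O[atTop] (fun _ => (1 : ℝ))
  φ_bdd : ∀ k, (fun J => (D J).φ k) =O[atTop] (fun _ => (1 : ℝ))
  d_top : ∀ k, Tendsto (fun J => (D J).d k) atTop atTop
  d_small : ∀ k, (fun J => (D J).d k) =o[atTop] (fun J : ℝ => J)
  e_top : ∀ k, Tendsto (fun J => (D J).e k) atTop atTop
  e_small : ∀ k, (fun J => (D J).e k) =o[atTop] (fun J : ℝ => J)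

/-! ### The fused error and L¹ convergence for frozen gains -/

section FusedError

variable {K : ℕ} {D : ℝ → Design K} {σ : Fin K → ℝ} {g : Fin K → ℕ → ℂ}

lemma Admissible.eventually_e_pos (hD : Admissible D) : ∀ᶠ J in atTop, ∀ k, 0 < (D J).e k :=
  eventually_all.mpr fun k => (hD.e_top k).eventually_gt_atTop 0

lemma Admissible.eventually_d_pos (hD : Admissible D) : ∀ᶠ J in atTop, ∀ k, 0 < (D J).d k :=
  eventually_all.mpr fun k => (hD.d_top k).eventually_gt_atTop 0

/-- The Fisher information of all sensors up to time `t`. -/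
noncomputable def totalU (σ : Fin K → ℝ) (g : Fin K → ℕ → ℂ) (t : ℕ) : ℝ :=
  ∑ k, localU (σ k) (g k) t

/-- One threshold on J serves all t, so the stopping time may be inserted. Each sensor gets the
share δ / K. -/
lemma eventually_abs_fusedU_sub_le (hK : 0 < K) (hD : Admissible D)
    (hg : ∀ k, RegularIncrements fun τ => 2 * ‖g k τ‖ ^ 2 / σ k ^ 2) {δ : ℝ} (hδ : 0 < δ) :
    ∀ᶠ J in atTop, ∀ t : ℕ, |fusedU (D J) σ g t - totalU σ g t| ≤ δ * (J + t) := by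
  have hK' : (0 : ℝ) < K := by exact_mod_cast hK
  choose M hM hb using fun k => (hg k).eventually_errorBound_le zero_le_one (hD.e_top k)
    (hD.e_small k) (fun J => hD.θ_pos J k) (hD.θ_bdd k) (div_pos hδ hK')
  filter_upwards [eventually_all.mpr hb, hD.eventually_e_pos] with J hJ he t
  rw [fusedU_eq he, totalU, ← Finset.sum_sub_distrib]
  refine (Finset.abs_sum_le_sum_abs _ _).trans ?_
  calc _ ≤ ∑ _k : Fin K, δ / K * (J + t) := Finset.sum_le_sum fun k _ =>
        (abs_sub_recovered_of_nonneg_le (fun τ => (hg k).nonneg τ) (he k) (hD.θ_pos J k)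
          (by positivity) (hM k) (localU_succ_sub (σ k) (g k)) t).trans (hJ k t)
    _ = δ * (J + t) := by
      rw [Finset.sum_const, Finset.card_univ, Fintype.card_fin, nsmul_eq_mul]
      field_simp

variable {part : ℂ → ℝ} {Ω : Type*} [MeasurableSpace Ω] {P : Measure Ω} [IsProbabilityMeasure P]
  {w : Fin K → ℕ → Ω → ℂ}

lemma integrable_sampledSum_localV (hp : Measurable part) {s d φ : ℝ} (hd : 0 < d) (hφ : 0 < φ)
    {L : ℕ} (hL : 0 < L) {v : ℕ → Ω → ℂ} (hv : ∀ t, Measurable (v t)) (g : ℕ → ℂ) (x : ℂ) (t : ℕ) :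
    Integrable (fun ω => sampledSum (localV part s g (fun τ => x * g τ + v τ ω))
      (Set.Ioo (-d) d)ᶜ (quantize d φ L) t) P := by
  refine Integrable.of_bound (measurable_sampledSum (measurable_localV hp s
    (g := fun _ => g) (fun _ => measurable_const) fun τ => (hv τ).const_add _)
    measurableSet_Ioo.compl (measurable_quantize _ _ _) t).aestronglyMeasurable (t * (d + φ))
    (ae_of_all _ fun ω => ?_)
  exact abs_sampledSum_le _ _ (add_pos hd hφ).le (abs_quantize_le hd hφ hL) t

lemma eventually_integral_abs_fusedV_sub_le (hK : 0 < K) (hD : Admissible D)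
    (hp : part = Complex.re ∨ part = Complex.im) (hσ : ∀ k, 0 < σ k)
    (hw_meas : ∀ k t, Measurable (w k t)) (hw_law : ∀ k t, P.map (w k t) = complexGaussian (σ k))
    (hw_indep : iIndepFun (fun i : Fin K × ℕ => w i.1 i.2) P) (x : ℂ)
    (hg : ∀ k, RegularIncrements fun τ => 2 * ‖g k τ‖ ^ 2 / σ k ^ 2) {δ : ℝ} (hδ : 0 < δ) :
    ∀ᶠ J in atTop, ∀ t : ℕ,
      Integrable (fun ω => fusedV (D J) part σ g (fun k τ => x * g k τ + w k τ ω) t) P ∧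
      ∫ ω, |fusedV (D J) part σ g (fun k τ => x * g k τ + w k τ ω) t - part x * totalU σ g t| ∂P
        ≤ δ * (J + t) := by
  have hK' : (0 : ℝ) < K := by exact_mod_cast hK
  choose M hM hb using fun k => (hg k).eventually_errorBound_le (abs_nonneg (part x)) (hD.d_top k)
    (hD.d_small k) (fun J => hD.φ_pos J k) (hD.φ_bdd k) (div_pos hδ hK')
  filter_upwards [eventually_all.mpr hb, hD.eventually_d_pos] with J hJ hd t
  have hi := fun k => integrable_sampledSum_localV (P := P) (s := σ k)
    (measurable_of_re_or_im hp) (hd k) (hD.φ_pos J k) (L := 2 ^ ((D J).rV - 1)) (by positivity)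
    (hw_meas k) (g k) x t
  simp only [fusedV_eq, totalU, Finset.mul_sum, ← Finset.sum_sub_distrib]
  refine ⟨integrable_finsetSum _ fun k _ => hi k, ?_⟩
  have hle := integral_mono_of_nonneg (ae_of_all P fun ω => abs_nonneg _)
    (integrable_finsetSum Finset.univ fun k _ => ((hi k).sub
      (integrable_const (part x * localU (σ k) (g k) t))).abs)
    (ae_of_all P fun ω => Finset.abs_sum_le_sum_abs _ _)
  refine hle.trans ?_
  rw [integral_finsetSum _ fun k _ => ((hi k).sub (integrable_const _)).abs]
  calc _ ≤ ∑ _k : Fin K, δ / K * (J + t) := Finset.sum_le_sum fun k _ =>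
        (integral_abs_sub_recovered_le hp (hσ k) (hw_meas k) (hw_law k)
          (hw_indep.precomp (g := fun τ : ℕ => (k, τ)) (Prod.mk_right_injective k)) (g k) x (hd k)
          (hD.φ_pos J k) (by positivity) (hM k) t).trans (hJ k t)
    _ = δ * (J + t) := by
      rw [Finset.sum_const, Finset.card_univ, Fintype.card_fin, nsmul_eq_mul]
      field_simp

/-- For regular gains, the estimate converges in mean to the parameter, and so it does conditionally
on the gains. -/
lemma eventually_integral_abs_estimateOf_sub_le (hK : 0 < K) (hD : Admissible D)
    (hp : part = Complex.re ∨ part = Complex.im) (hσ : ∀ k, 0 < σ k)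
    (hw_meas : ∀ k t, Measurable (w k t)) (hw_law : ∀ k t, P.map (w k t) = complexGaussian (σ k))
    (hw_indep : iIndepFun (fun i : Fin K × ℕ => w i.1 i.2) P) (x : ℂ)
    (hg : ∀ k, RegularIncrements fun τ => 2 * ‖g k τ‖ ^ 2 / σ k ^ 2) {ε : ℝ} (hε : 0 < ε) :
    ∀ᶠ J in atTop,
      Integrable (fun ω => estimateOf (D J) part σ x
        ((stopTime (D J) σ J g, g), fun i => w i.1 i.2 ω)) P ∧
      ∫ ω, |estimateOf (D J) part σ x ((stopTime (D J) σ J g, g), fun i => w i.1 i.2 ω) - part x| ∂P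
        ≤ ε := by
  obtain ⟨μ, C, hμ, hlow⟩ := (hg ⟨0, hK⟩).lower
  have hlow' : ∀ t : ℕ, μ * t ≤ totalU σ g t + C := fun t => (hlow t).trans (by
    have : localU (σ ⟨0, hK⟩) (g ⟨0, hK⟩) t ≤ totalU σ g t :=
      Finset.single_le_sum (f := fun k => localU (σ k) (g k) t)
        (fun k _ => Finset.sum_nonneg fun τ _ => (hg k).nonneg τ) (Finset.mem_univ _)
    rw [localU] at this
    linarith)
  set A := 2 / μ * (2 + μ / 2) + 1 with hA
  have hApos : 0 < A := by positivity
  set δ := min (μ / 2) (ε / ((1 + |part x|) * (1 + A))) with hδdef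
  have hδ : 0 < δ := lt_min (half_pos hμ) (by positivity)
  have hδ1 : δ ≤ μ / 2 := min_le_left _ _
  have hδ2 : δ * ((1 + |part x|) * (1 + A)) ≤ ε := by
    rw [← le_div_iff₀ (by positivity)]
    exact min_le_right _ _
  filter_upwards [eventually_abs_fusedU_sub_le hK hD hg hδ,
    eventually_integral_abs_fusedV_sub_le hK hD hp hσ hw_meas hw_law hw_indep x hg hδ,
    eventually_ge_atTop (1 : ℝ), eventually_ge_atTop C] with J hU hV hJ1 hJC
  have hex : ∃ t, J ≤ fusedU (D J) σ g t := by
    obtain ⟨t, ht⟩ := exists_nat_ge ((J + C + δ * J) / (μ / 2))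
    refine ⟨t, ?_⟩
    rw [div_le_iff₀ (half_pos hμ)] at ht
    have h1 := (neg_le_abs _).trans (hU t)
    have h2 := hlow' t
    have h3 : δ * t ≤ μ / 2 * t := by gcongr
    linarith
  have hTJ := le_fusedU_stopTime hex
  have hTle : (stopTime (D J) σ J g : ℝ) ≤ A * J := by
    rcases Nat.eq_zero_or_pos (stopTime (D J) σ J g) with h0 | h0
    · rw [h0]
      push_cast
      positivity
    · obtain ⟨t, ht⟩ := Nat.exists_eq_succ_of_ne_zero h0.ne'
      have h1 : fusedU (D J) σ g t < J := lt_of_lt_stopTime (by omega)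
      have h2 := (neg_le_abs _).trans (hU t)
      have h3 := hlow' t
      have h4 : δ * t ≤ μ / 2 * t := by gcongr
      have h5 : δ * J ≤ μ / 2 * J := by gcongr
      have h6 : μ / 2 * t ≤ (2 + μ / 2) * J := by linarith
      have h7 : (t : ℝ) ≤ 2 / μ * (2 + μ / 2) * J := by
        calc (t : ℝ) = 2 / μ * (μ / 2 * t) := by field_simp
          _ ≤ 2 / μ * ((2 + μ / 2) * J) := by gcongr
          _ = _ := by ring
      rw [ht, hA]
      push_cast
      linarith
  generalize stopTime (D J) σ J g = T at hTJ hTle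
  obtain ⟨hVi, hVT⟩ := hV T
  have hUT := hU T
  simp only [estimateOf]
  set u := fusedU (D J) σ g T with hu
  have hupos : 0 < u := by linarith
  refine ⟨hVi.div_const u, ?_⟩
  have hpt : ∀ ω, |fusedV (D J) part σ g (fun k t => x * g k t + w k t ω) T / u - part x| ≤
      (|fusedV (D J) part σ g (fun k t => x * g k t + w k t ω) T - part x * totalU σ g T| +
        |part x| * (δ * (J + T))) / J := fun ω => by
    generalize fusedV (D J) part σ g (fun k t => x * g k t + w k t ω) T = V
    -- Both recovered statistics are compared with the exact U, and the denominator is at least J.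
    have h1 : V / u - part x = ((V - part x * totalU σ g T) - part x * (u - totalU σ g T)) / u := by
      field_simp
      ring
    rw [h1, abs_div, abs_of_pos hupos]
    gcongr
    refine (abs_sub _ _).trans ?_
    rw [abs_mul]
    gcongr
  have hle := integral_mono_of_nonneg (ae_of_all P fun ω => abs_nonneg _)
    (((hVi.sub (integrable_const (part x * totalU σ g T))).abs.add
      (integrable_const (|part x| * (δ * (J + T))))).div_const J) (ae_of_all P hpt)
  refine hle.trans ?_
  have hVi' : Integrable (fun ω =>
      |fusedV (D J) part σ g (fun k τ => x * g k τ + w k τ ω) T - part x * totalU σ g T|) P :=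
    (hVi.sub (integrable_const _)).abs
  simp only [Pi.add_apply, Pi.sub_apply]
  rw [integral_div, integral_add hVi' (integrable_const _),
    integral_const, probReal_univ, one_smul, div_le_iff₀ (by linarith)]
  have h1 : δ * (J + T) ≤ δ * ((1 + A) * J) := by
    gcongr
    linarith
  have h2 : |part x| * (δ * (J + T)) ≤ |part x| * (δ * ((1 + A) * J)) := by gcongr
  have h3 : δ * ((1 + |part x|) * (1 + A)) * J ≤ ε * J := by gcongr
  linarith

end FusedError

/-! ### Conditioning on an independent variable -/

section Conditional

variable {Ω : Type*} [MeasurableSpace Ω] {P : Measure Ω} [IsProbabilityMeasure P]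

/-- The conditional expectation of `f (Y, W)` given `Y`, when `Y` and `W` are independent. -/
lemma condExp_comap_ae_eq_integral {α β : Type*} [MeasurableSpace α] [mβ : MeasurableSpace β]
    [StandardBorelSpace β] [Nonempty β] {Y : Ω → α} {W : Ω → β} (hY : Measurable Y)
    (hW : Measurable W) (hYW : IndepFun Y W P) {f : α × β → ℝ} (hf : Measurable f)
    (hint : Integrable (fun ω => f (Y ω, W ω)) P) :
    P[fun ω => f (Y ω, W ω) | MeasurableSpace.comap Y inferInstance] =ᵐ[P]
      fun ω => ∫ ω', f (Y ω, W ω') ∂P := by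
  have : IsProbabilityMeasure (P.map W) := Measure.isProbabilityMeasure_map hW.aemeasurable
  have : IsProbabilityMeasure (P.map Y) := Measure.isProbabilityMeasure_map hY.aemeasurable
  have h1 := condExp_prod_ae_eq_integral_condDistrib hY hW.aemeasurable hf.stronglyMeasurable hint
  -- Independence makes the joint law a product, so the conditional law of W is constant.
  have h2 : condDistrib W Y P =ᵐ[P.map Y] Kernel.const α (P.map W) := by
    refine condDistrib_ae_eq_of_measure_eq_compProd Y hW.aemeasurable ?_
    rw [Measure.compProd_const]
    exact (indepFun_iff_map_prod_eq_prod_map_map hY.aemeasurable hW.aemeasurable).mp hYW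
  filter_upwards [h1, ae_of_ae_map hY.aemeasurable h2] with ω h3 h4
  rw [h3, h4, Kernel.const_apply, integral_map hW.aemeasurable]
  exact (hf.comp measurable_prodMk_left).aestronglyMeasurable

/-- Conditional consistency implies convergence in probability. -/
lemma tendstoInMeasure_of_condExp {m : ℝ → MeasurableSpace Ω} {X : ℝ → Ω → ℝ} {a : ℝ}
    (hm : ∀ᶠ J in atTop, m J ≤ ‹MeasurableSpace Ω›) (hX : ∀ᶠ J in atTop, Measurable (X J))
    (h : ∀ ε : ℝ, 0 < ε → ∀ J : ℕ → ℝ, Tendsto J atTop atTop →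
      ∀ᵐ ω ∂P, Tendsto (fun n => (P⟦{ω' | ε ≤ |X (J n) ω' - a|} | m (J n)⟧) ω) atTop (𝓝 0)) :
    TendstoInMeasure P X atTop fun _ => a := by
  rw [tendstoInMeasure_iff_measureReal_norm]
  refine fun ε hε => tendsto_of_seq_tendsto fun J hJ => ?_
  have h1 : Tendsto (fun n => ∫ ω, (P⟦{ω' | ε ≤ |X (J n) ω' - a|} | m (J n)⟧) ω ∂P) atTop
      (𝓝 (∫ _ω, (0 : ℝ) ∂P)) := by
    refine tendsto_integral_of_dominated_convergence (fun _ => 1)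
      (fun n => integrable_condExp.aestronglyMeasurable) (integrable_const _) (fun n => ?_)
      (h ε hε J hJ)
    refine ae_bdd_abs_condExp_of_ae_bdd_abs (R := (1 : ℝ)) (ae_of_all _ fun ω => ?_)
    by_cases hω : ω ∈ {ω' | ε ≤ |X (J n) ω' - a|}
    · rw [Set.indicator_of_mem hω]; simp
    · rw [Set.indicator_of_notMem hω]; simp
  rw [integral_zero] at h1
  refine h1.congr' ?_
  filter_upwards [hJ.eventually hm, hJ.eventually hX] with n h2 h3
  have h4 : MeasurableSet {ω' | ε ≤ |X (J n) ω' - a|} :=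
    measurableSet_le measurable_const (h3.sub_const a).abs
  rw [integral_condExp h2, integral_indicator h4]
  simp [Real.norm_eq_abs]

end Conditional

/-! ### From frozen gains to conditional expectations -/

section Main

variable {K : ℕ} {D : ℝ → Design K} {σ : Fin K → ℝ} {part : ℂ → ℝ}
  {Ω : Type*} [MeasurableSpace Ω] {P : Measure Ω} [IsProbabilityMeasure P]
  {w h : Fin K → ℕ → Ω → ℂ} {T : ℝ → Ω → ℕ} {X : ℝ → Ω → ℝ}

lemma measurable_T (hT : ∀ J ω, T J ω = stopTime (D J) σ J (fun k t => h k t ω))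
    (hh_meas : ∀ k t, Measurable (h k t)) {J : ℝ} (he : ∀ k, 0 < (D J).e k) : Measurable (T J) := by
  rw [funext (hT J)]
  exact measurable_stopTime he J hh_meas

lemma gainsUpTo_le (hh_meas : ∀ k t, Measurable (h k t)) {N : Ω → ℕ} (hN : Measurable N) :
    gainsUpTo h N ≤ ‹MeasurableSpace Ω› :=
  (hN.prodMk (measurable_mask hN (g := fun ω k t => h k t ω) hh_meas)).comap_le

/-- Conditional expectations of functions of the estimate are integrals over the noise. -/
lemma condExp_estimate_ae_eq (hp : part = Complex.re ∨ part = Complex.im) (x : ℂ)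
    (hw_meas : ∀ k t, Measurable (w k t)) (hh_meas : ∀ k t, Measurable (h k t))
    (hhw : IndepFun (fun ω (i : Fin K × ℕ) => h i.1 i.2 ω)
      (fun ω (i : Fin K × ℕ) => w i.1 i.2 ω) P)
    (hT : ∀ J ω, T J ω = stopTime (D J) σ J (fun k t => h k t ω))
    (hX : ∀ J ω, X J ω = estimate (D J) part σ J (fun k t => h k t ω)
      (fun k t => x * h k t ω + w k t ω))
    {J : ℝ} (he : ∀ k, 0 < (D J).e k) {F : ℝ → ℝ} (hF : Measurable F)
    (hint : Integrable (fun ω => F (X J ω)) P) :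
    P[fun ω => F (X J ω) | gainsUpTo h (T J)] =ᵐ[P] fun ω => ∫ ω', F (estimateOf (D J) part σ x
      ((stopTime (D J) σ J (fun k t => h k t ω), fun k t => h k t ω), fun i => w i.1 i.2 ω')) ∂P := by
  set Y : Ω → ℕ × (Fin K → ℕ → ℂ) := fun ω => (T J ω, mask (T J ω) fun k t => h k t ω) with hY
  set W : Ω → Fin K × ℕ → ℂ := fun ω i => w i.1 i.2 ω with hW
  have hTm := measurable_T hT hh_meas he
  have hYm : Measurable Y := hTm.prodMk (measurable_mask hTm hh_meas)
  have hWm : Measurable W := measurable_pi_lambda _ fun i => hw_meas i.1 i.2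
  -- The stopping time is computed from the gains alone, so Y is a function of them and inherits
  -- their independence of the noise.
  have hind : IndepFun Y W P := by
    have hc : ∀ k t, Measurable fun a : Fin K × ℕ → ℂ => a (k, t) := fun k t =>
      measurable_pi_apply _
    have hs := measurable_stopTime (D := D J) (σ := σ) he J
      (g := fun (a : Fin K × ℕ → ℂ) k t => a (k, t)) hc
    have h1 := hhw.comp (hs.prodMk (measurable_mask hs hc)) measurable_id
    have h2 : Y = (fun a : Fin K × ℕ → ℂ => (stopTime (D J) σ J (fun k t => a (k, t)),
        mask (stopTime (D J) σ J (fun k t => a (k, t))) (fun k t => a (k, t)))) ∘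
        (fun ω (i : Fin K × ℕ) => h i.1 i.2 ω) := by
      ext1 ω
      simp only [hY, hT, Function.comp_apply]
    rw [h2]
    exact h1
  have hXY : ∀ ω, X J ω = estimateOf (D J) part σ x (Y ω, W ω) := fun ω => by
    rw [hX, hY, hW, estimateOf_mask he, hT]
    rfl
  have hf : Measurable fun p => F (estimateOf (D J) part σ x p) :=
    hF.comp (measurable_estimateOf he (measurable_of_re_or_im hp) x)
  simp only [hXY] at hint ⊢
  filter_upwards [condExp_comap_ae_eq_integral hYm hWm hind hf hint] with ω hω
  refine hω.trans ?_
  simp only [hY, estimateOf_mask he, hT, hW]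

/-- The general F treats both claims at once: F r = r - a gives unbiasedness, and the indicator of ε
≤ |r - a| gives conditional consistency. -/
lemma ae_tendsto_condExp_estimate (hK : 0 < K) (hD : Admissible D)
    (hp : part = Complex.re ∨ part = Complex.im) (x : ℂ) (hσ : ∀ k, 0 < σ k)
    (hw_meas : ∀ k t, Measurable (w k t)) (hw_law : ∀ k t, P.map (w k t) = complexGaussian (σ k))
    (hw_indep : iIndepFun (fun i : Fin K × ℕ => w i.1 i.2) P)
    (hh_meas : ∀ k t, Measurable (h k t))
    (hhw : IndepFun (fun ω (i : Fin K × ℕ) => h i.1 i.2 ω)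
      (fun ω (i : Fin K × ℕ) => w i.1 i.2 ω) P)
    (hreg : ∀ᵐ ω ∂P, ∀ k, RegularIncrements fun τ => 2 * ‖h k τ ω‖ ^ 2 / σ k ^ 2)
    (hT : ∀ J ω, T J ω = stopTime (D J) σ J (fun k t => h k t ω))
    (hX : ∀ J ω, X J ω = estimate (D J) part σ J (fun k t => h k t ω)
      (fun k t => x * h k t ω + w k t ω))
    (hint : ∀ᶠ J in atTop, Integrable (X J) P)
    {F : ℝ → ℝ} (hF : Measurable F) {c : ℝ} (hc : 0 ≤ c) (hFc : ∀ r, |F r| ≤ c * |r - part x|)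
    {J : ℕ → ℝ} (hJ : Tendsto J atTop atTop) :
    ∀ᵐ ω ∂P, Tendsto (fun n => (P[fun ω' => F (X (J n) ω') | gainsUpTo h (T (J n))]) ω)
      atTop (𝓝 0) := by
  -- The identity needs conditions that hold only for large n; as implications they let the
  -- countably many null sets be merged over all n.
  have hce : ∀ n, ∀ᵐ ω ∂P, (∀ k, 0 < (D (J n)).e k) → Integrable (X (J n)) P →
      (P[fun ω' => F (X (J n) ω') | gainsUpTo h (T (J n))]) ω =
        ∫ ω', F (estimateOf (D (J n)) part σ x ((stopTime (D (J n)) σ (J n) (fun k t => h k t ω),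
          fun k t => h k t ω), fun i => w i.1 i.2 ω')) ∂P := by
    intro n
    by_cases he : ∀ k, 0 < (D (J n)).e k
    · by_cases hi : Integrable (X (J n)) P
      · have hFi : Integrable (fun ω => F (X (J n) ω)) P :=
          Integrable.mono' ((hi.sub (integrable_const (part x))).abs.const_mul c)
            (hF.comp_aemeasurable hi.1.aemeasurable).aestronglyMeasurable
            (ae_of_all _ fun ω => hFc _)
        filter_upwards [condExp_estimate_ae_eq hp x hw_meas hh_meas hhw hT hX he hF hFi]
          with ω hω _ _ using hω
      · exact ae_of_all _ fun ω _ hi' => absurd hi' hi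
    · exact ae_of_all _ fun ω he' => absurd he' he
  filter_upwards [ae_all_iff.mpr hce, hreg] with ω hω hg
  rw [Metric.tendsto_nhds]
  intro ε hε
  have hev := hJ.eventually (eventually_integral_abs_estimateOf_sub_le (P := P) (w := w) hK hD hp hσ
    hw_meas hw_law hw_indep x (g := fun k t => h k t ω) hg
    (ε := ε / (c + 1)) (by positivity))
  filter_upwards [hev, hJ.eventually hD.eventually_e_pos, hJ.eventually hint] with n hn he hi
  rw [hω n he hi, Real.dist_eq, sub_zero]
  have h1 := integral_mono_of_nonneg (ae_of_all P fun ω => abs_nonneg _)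
    ((hn.1.sub (integrable_const (part x))).abs.const_mul c) (ae_of_all P fun ω' => hFc
      (estimateOf (D (J n)) part σ x ((stopTime (D (J n)) σ (J n) (fun k t => h k t ω),
          fun k t => h k t ω), fun i => w i.1 i.2 ω')))
  refine (abs_integral_le_integral_abs.trans h1).trans_lt ?_
  rw [integral_const_mul]
  calc _ ≤ c * (ε / (c + 1)) := mul_le_mul_of_nonneg_left hn.2 hc
    _ < ε := by
      rw [← mul_div_assoc, div_lt_iff₀ (by positivity)]
      nlinarith

lemma asympUnbiased_and_consistent (hK : 0 < K) (hD : Admissible D)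
    (hp : part = Complex.re ∨ part = Complex.im) (x : ℂ) (hσ : ∀ k, 0 < σ k)
    (hw_meas : ∀ k t, Measurable (w k t)) (hw_law : ∀ k t, P.map (w k t) = complexGaussian (σ k))
    (hw_indep : iIndepFun (fun i : Fin K × ℕ => w i.1 i.2) P)
    (hh_meas : ∀ k t, Measurable (h k t))
    (hhw : IndepFun (fun ω (i : Fin K × ℕ) => h i.1 i.2 ω)
      (fun ω (i : Fin K × ℕ) => w i.1 i.2 ω) P)
    (hreg : ∀ᵐ ω ∂P, ∀ k, RegularIncrements fun τ => 2 * ‖h k τ ω‖ ^ 2 / σ k ^ 2)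
    (hT : ∀ J ω, T J ω = stopTime (D J) σ J (fun k t => h k t ω))
    (hX : ∀ J ω, X J ω = estimate (D J) part σ J (fun k t => h k t ω)
      (fun k t => x * h k t ω + w k t ω))
    (hint : ∀ᶠ J in atTop, Integrable (X J) P) :
    AsympUnbiased P (fun J => gainsUpTo h (T J)) X (part x) ∧
      Consistent P (fun J => gainsUpTo h (T J)) X (part x) := by
  have hXm : ∀ᶠ J in atTop, Measurable (X J) := by
    filter_upwards [hD.eventually_e_pos] with J he
    rw [funext (hX J)]
    exact measurable_estimate he (measurable_of_re_or_im hp) J x hh_meas hw_meas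
  have hcons : ∀ ε : ℝ, 0 < ε → ∀ J : ℕ → ℝ, Tendsto J atTop atTop → ∀ᵐ ω ∂P,
      Tendsto (fun n => (P⟦{ω' | ε ≤ |X (J n) ω' - part x|} | gainsUpTo h (T (J n))⟧) ω)
        atTop (𝓝 0) := by
    intro ε hε J hJ
    have heq : ∀ n, {ω' | ε ≤ |X (J n) ω' - part x|}.indicator (fun _ => (1 : ℝ)) =
        fun ω' => {r : ℝ | ε ≤ |r - part x|}.indicator (fun _ => 1) (X (J n) ω') := fun n => by
      ext ω'
      simp only [Set.indicator_apply, Set.mem_ofPred_eq]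
    simp only [heq]
    refine ae_tendsto_condExp_estimate (F := {r : ℝ | ε ≤ |r - part x|}.indicator fun _ => (1 : ℝ))
      hK hD hp x hσ hw_meas hw_law hw_indep hh_meas hhw hreg hT hX hint
      (measurable_const.indicator
        (measurableSet_le measurable_const (measurable_id.sub_const _).abs))
      -- Markov's inequality: the indicator is at most |r - a| / ε.
      (c := 1 / ε) (by positivity) (fun r => ?_) hJ
    by_cases hr : r ∈ {r : ℝ | ε ≤ |r - part x|}
    · have hr' : ε ≤ |r - part x| := hr
      rw [Set.indicator_of_mem hr, abs_one, one_div_mul_eq_div, le_div_iff₀ hε, one_mul]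
      exact hr'
    · rw [Set.indicator_of_notMem hr, abs_zero]
      positivity
  have hm : ∀ᶠ J in atTop, gainsUpTo h (T J) ≤ ‹MeasurableSpace Ω› := by
    filter_upwards [hD.eventually_e_pos] with J he
    exact gainsUpTo_le hh_meas (measurable_T hT hh_meas he)
  have hunb : ∀ J : ℕ → ℝ, Tendsto J atTop atTop → ∀ᵐ ω ∂P,
      Tendsto (fun n => (P[fun ω' => X (J n) ω' - part x | gainsUpTo h (T (J n))]) ω)
        atTop (𝓝 0) := fun J hJ =>
    ae_tendsto_condExp_estimate (F := fun r => r - part x)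
      hK hD hp x hσ hw_meas hw_law hw_indep hh_meas hhw hreg hT hX hint
      (measurable_id.sub_const _) (c := 1) zero_le_one (fun r => (one_mul _).ge) hJ
  have htim : TendstoInMeasure P X atTop fun _ => part x :=
    tendstoInMeasure_of_condExp (m := fun J => gainsUpTo h (T J)) hm hXm hcons
  exact ⟨⟨hint, hunb⟩, htim, hcons⟩

end Main

end LTdsDMLE

/-! ### The theorem -/

theorem theorem6 {Ω : Type*} [MeasurableSpace Ω] (P : Measure Ω) [IsProbabilityMeasure P]
    (K : ℕ) (hK : 0 < K)
    -- the parameter, with (A1)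
    (x : ℂ) (hx_re : x.re ≠ 0) (hx_im : x.im ≠ 0)
    -- complex Gaussian noise, independent across sensors and time
    (σ : Fin K → ℝ) (hσ : ∀ k, 0 < σ k)
    (w : Fin K → ℕ → Ω → ℂ) (hw_meas : ∀ k t, Measurable (w k t))
    (hw_law : ∀ k t, P.map (w k t) = LTdsDMLE.complexGaussian (σ k))
    (hw_indep : iIndepFun (fun i : Fin K × ℕ => w i.1 i.2) P)
    -- channel gains, i.i.d. across time, with finite Fisher information, independent of the noise
    (h : Fin K → ℕ → Ω → ℂ) (hh_meas : ∀ k t, Measurable (h k t))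
    (hh_indep : ∀ k, iIndepFun (h k) P)
    (hh_ident : ∀ k t, IdentDistrib (h k t) (h k 0) P P)
    (hh_sq : ∀ k, Integrable (fun ω => ‖h k 0 ω‖ ^ 2) P)
    (hhw : IndepFun (fun ω (i : Fin K × ℕ) => h i.1 i.2 ω)
      (fun ω (i : Fin K × ℕ) => w i.1 i.2 ω) P)
    -- (A2)
    (hh_ne : ∀ k t, ∀ᵐ ω ∂P, h k t ω ≠ 0)
    -- the observations
    (y : Fin K → ℕ → Ω → ℂ) (hy : ∀ k t ω, y k t ω = x * h k t ω + w k t ω)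
    -- the design of the scheme as a function of the target Fisher information
    (D : ℝ → LTdsDMLE.Design K)
    (hrU : ∀ J, 1 ≤ (D J).rU) (hrV : ∀ J, 1 ≤ (D J).rV)
    (hθ_pos : ∀ J k, 0 < (D J).θ k) (hφ_pos : ∀ J k, 0 < (D J).φ k)
    (hθ : ∀ k, (fun J => (D J).θ k) =O[atTop] (fun _ => (1 : ℝ)))
    (hφ : ∀ k, (fun J => (D J).φ k) =O[atTop] (fun _ => (1 : ℝ)))
    (hd_top : ∀ k, Tendsto (fun J => (D J).d k) atTop atTop)
    (hd : ∀ k, (fun J => (D J).d k) =o[atTop] (fun J : ℝ => J))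
    (he_top : ∀ k, Tendsto (fun J => (D J).e k) atTop atTop)
    (he : ∀ k, (fun J => (D J).e k) =o[atTop] (fun J : ℝ => J))
    -- the stopping time, the channel information at the stopping time, and the estimators of the
    -- real and of the imaginary part
    (T : ℝ → Ω → ℕ) (hT : ∀ J ω, T J ω = LTdsDMLE.stopTime (D J) σ J (fun k t => h k t ω))
    (m : ℝ → MeasurableSpace Ω) (hm : ∀ J, m J = LTdsDMLE.gainsUpTo h (T J))
    (Xre Xim : ℝ → Ω → ℝ)
    (hXre : ∀ J ω, Xre J ω =
      LTdsDMLE.estimate (D J) Complex.re σ J (fun k t => h k t ω) (fun k t => y k t ω))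
    (hXim : ∀ J ω, Xim J ω =
      LTdsDMLE.estimate (D J) Complex.im σ J (fun k t => h k t ω) (fun k t => y k t ω)) :
    -- the scheme stops almost surely
    (∀ᶠ J in atTop, ∀ᵐ ω ∂P, ∃ t, J ≤ LTdsDMLE.fusedU (D J) σ (fun k t => h k t ω) t) ∧
    LTdsDMLE.AsympUnbiased P m Xre x.re ∧ LTdsDMLE.Consistent P m Xre x.re ∧
    LTdsDMLE.AsympUnbiased P m Xim x.im ∧ LTdsDMLE.Consistent P m Xim x.im := by
  have hD : LTdsDMLE.Admissible D := ⟨hθ_pos, hφ_pos, hθ, hφ, hd_top, hd, he_top, he⟩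
  have hpos : ∀ k, ∀ᵐ ω ∂P, 0 < 2 * ‖h k 0 ω‖ ^ 2 / σ k ^ 2 := fun k => by
    filter_upwards [hh_ne k 0] with ω hω
    have := hσ k
    have := norm_pos_iff.mpr hω
    positivity
  have hreg : ∀ᵐ ω ∂P, ∀ k,
      LTdsDMLE.RegularIncrements fun τ => 2 * ‖h k τ ω‖ ^ 2 / σ k ^ 2 := by
    refine ae_all_iff.mpr fun k => ?_
    have hf : Measurable fun z : ℂ => 2 * ‖z‖ ^ 2 / σ k ^ 2 := by fun_prop
    exact LTdsDMLE.ae_regularIncrements ((hh_indep k).comp _ fun _ => hf)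
      (fun n => (hh_ident k n).comp hf) (((hh_sq k).const_mul 2).div_const _)
      (fun n ω => by positivity) (hpos k)
  simp only [hy] at hXre hXim
  obtain rfl : m = fun J => LTdsDMLE.gainsUpTo h (T J) := funext hm
  -- The geometric tail from sensor 0 gives both almost sure stopping and integrability.
  have htail := fun J (he' : ∀ k, 0 < (D J).e k) =>
    LTdsDMLE.exists_measure_fusedU_lt_le_geometric (P := P) hσ he' (hθ_pos J) ⟨0, hK⟩ hh_meas
      (hh_indep _) (hh_ident _) (hh_ne _ 0) J
  have hint : ∀ part : ℂ → ℝ, Measurable part → ∀ X : ℝ → Ω → ℝ,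
      (∀ J ω, X J ω = LTdsDMLE.estimate (D J) part σ J (fun k t => h k t ω)
        (fun k t => x * h k t ω + w k t ω)) → ∀ᶠ J in atTop, Integrable (X J) P := by
    intro part hp X hX
    filter_upwards [hD.eventually_e_pos, hD.eventually_d_pos, eventually_gt_atTop (0 : ℝ)]
      with J he' hd' hJ
    obtain ⟨C, ρ, hρ, hρ1, hb⟩ := htail J he'
    rw [funext (hX J)]
    exact LTdsDMLE.integrable_estimate he' hd' (hφ_pos J) hp hJ x hh_meas hw_meas hρ hρ1 hb
  have hre := LTdsDMLE.asympUnbiased_and_consistent hK hD (Or.inl rfl) x hσ hw_meas hw_law hw_indep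
    hh_meas hhw hreg hT hXre (hint _ Complex.measurable_re _ hXre)
  have him := LTdsDMLE.asympUnbiased_and_consistent hK hD (Or.inr rfl) x hσ hw_meas hw_law hw_indep
    hh_meas hhw hreg hT hXim (hint _ Complex.measurable_im _ hXim)
  refine ⟨?_, hre.1, hre.2, him.1, him.2⟩
  filter_upwards [hD.eventually_e_pos] with J he'
  obtain ⟨C, ρ, hρ, hρ1, hb⟩ := htail J he'
  exact LTdsDMLE.ae_exists_le_fusedU hρ hρ1 hb
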